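/- Let $b\ge 2$ be an integer, $\mathbb K$ a field of characteristic zero, $\overline{\mathbb K}$ an algebraic closure of $\mathbb K$, and $\mathbb L$ a field with $\mathbb K\subseteq\mathbb L\subseteq\overline{\mathbb K}$. For a field $E$ let $E((x^{1/q}))$ be the field of Laurent series in $x^{1/q}$, let $\mathrm{Puiseux}(E)=\bigcup_{q\ge1}E((x^{1/q}))$, and let $M$ be the Mahler operator $f(x)\mapsto f(x^b)$. Let $D_E$ be the $\mathrm{Puiseux}(E)$-algebra with basis $(e_\lambda)_{\lambda\in E\setminus\{0\}}$ and relations $e_\lambda e_\mu=e_{\lambda\mu}$, $e_1=1$; extend $M$ to a ring endomorphism of $D_E$ by $Me_\lambda=\lambda e_\lambda$. An element $y\in D_E$ is hypergeometric if $My=uy$ for some $u\in\mathrm{Puiseux}(E)$. Let $r\in\mathbb N$ and $\ell_0,\dots,\ell_r\in\mathbb K[x]$ with $\ell_0\ne0$ and $\ell_r\neq0$. Consider the linear operator $L=\sum_{k=0}^r\ell_kM^k$ and the Riccati Mahler equation $$\ell_r\,u\,Mu\cdots M^{r-1}u+\dots+\ell_2\,u\,Mu+\ell_1u+\ell_0=0.\tag{R}$$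 Write $\ell_k=\sum_j\ell_{k,j}x^j$. The lower Newton polygon of $L$ is the lower convex hull of the points $(b^k,j)$ with $\ell_{k,j}\ne0$. The characteristic polynomial of an edge whose left end point has abscissa $b^{k_1}$ is $\chi(X)=\sum\ell_{k,j}X^{k-k_1}$, summed over the points $(b^k,j)$ on the edge; the edge is $\lambda$-admissible if $\chi(\lambda)=0$. Let $\Lambda\subset\overline{\mathbb K}$ be the set of all roots of the characteristic polynomials of the edges, and let $q_\lambda$ be the lcm of those denominators of slopes of $\lambda$-admissible edges that are coprime with $b$. Let $\Lambda'$ be the set of $\lambda\in\Lambda$ such that $Ly=0$ has a nonzero solution $y\in e_\lambda\,\mathrm{Puiseux}(\overline{\mathbb K})$. For $\lambda\in\mathbb L\cap\Lambda'$ let $\mathfrak H_{\mathbb L,\lambda}$ be the $\mathbb L$-vector space of the hypergeometric solutions of $Ly=0$ in $e_\lambda\,\mathrm{Puiseux}(\mathbb L)\subseteq D_{\mathbb L}$, and let $\mathfrak R_{\mathbb L,\lambda}\subseteq\mathrm{Puiseux}(\mathbb L)$ be the image of $\mathfrak H_{\mathbb L,\lambda}\setminus\{0\}$ under $y\mapsto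 My/y$. **Theorem.** The set $\mathbb L\cap\Lambda'$ is finite, and the set of solutions $u\in\mathrm{Puiseux}(\mathbb L)$ of (R) is the disjoint union $$\coprod_{\lambda\in\mathbb L\cap\Lambda'}\mathfrak R_{\mathbb L,\lambda}.$$ For each $\lambda\in\mathbb L\cap\Lambda'$: * every element of $\mathfrak R_{\mathbb L,\lambda}$ lies in $\mathbb L((x^{1/q_\lambda}))$ and has leading coefficient $\lambda$; * $\mathfrak H_{\mathbb L,\lambda}$ is nonzero and finite-dimensional over $\mathbb L$, every nonzero element of it is invertible in $D_{\mathbb L}$, and $y\mapsto My/y$ induces a bijection from the projective space $\mathbb P(\mathfrak H_{\mathbb L,\lambda})$ onto $\mathfrak R_{\mathbb L,\lambda}$. This bijection is rational: in the homogeneous coordinates given by any $\mathbb L$-basis of $\mathfrak H_{\mathbb L,\lambda}$, it is a quotient of two homogeneous polynomials of the same degree with coefficients in $\mathrm{Puiseux}(\mathbb L)$, the denominator having no zero on $\mathbb P(\mathfrak H_{\mathbb L,\lambda})$. Moreover, $$\sum_{\lambda\in\mathbb L\cap\Lambda'}\dim\mathbb P(\mathfrak H_{\mathbb L,\lambda})\;\le\;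 r-\#(\mathbb L\cap\Lambda'),\qquad\text{where }\dim\mathbb P(\mathfrak H_{\mathbb L,\lambda})=\dim_{\mathbb L}\mathfrak H_{\mathbb L,\lambda}-1.$$ -/

import Mathlib

noncomputable section

namespace MahlerRiccati

open HahnSeries Polynomial

/-! ### Puiseux series and the Mahler operator on them

`HahnSeries ℚ E` consists of the formal series in `x` with coefficients in `E` and rational
exponents with well-ordered support. -/

/-- The coefficientwise algebra structure is the one used throughout. -/
instance (priority := 2000) hahnAlgebra (Γ E : Type*) [AddCommGroup Γ] [LinearOrder Γ]
    [IsOrderedAddMonoid Γ] [Field E] : Algebra E (HahnSeries Γ E) :=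
  HahnSeries.instAlgebra

/-- Embedding of Laurent series into series with rational exponents that sends `x` to
`x ^ (1 / q)`. -/
def laurentRoot (E : Type*) [Field E] (q : ℕ) (hq : 0 < q) :
    HahnSeries ℤ E →ₐ[E] HahnSeries ℚ E :=
  embDomainAlgHom
    ({ toFun := fun n => (n : ℚ) / q
       map_zero' := by simp
       map_add' := fun m n => by push_cast; ring } : ℤ →+ ℚ)
    (fun m n h => by
      have hq' : (q : ℚ) ≠ 0 := by positivity
      have h' : (m : ℚ) / q = (n : ℚ) / q := h
      exact_mod_cast (div_left_inj' hq').1 h')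
    (fun m n => by
      have hq' : (0 : ℚ) < q := by positivity
      change (m : ℚ) / q ≤ (n : ℚ) / q ↔ m ≤ n
      rw [div_le_div_iff_of_pos_right hq']
      exact_mod_cast Iff.rfl)

/-- The field `E((x^{1/q}))` for `q ≥ 1`, inside the series with rational exponents. -/
def ramifiedLaurent (E : Type*) [Field E] (q : ℕ) (hq : 0 < q) :
    IntermediateField E (HahnSeries ℚ E) :=
  (laurentRoot E q hq).fieldRange

/-- A series with rational exponents lies in `E((x^{1/q}))` iff all its exponents
lie in `(1/q)ℤ`. -/
theorem mem_ramifiedLaurent_iff {E : Type*} [Field E] {q : ℕ} (hq : 0 < q)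
    (f : HahnSeries ℚ E) :
    f ∈ ramifiedLaurent E q hq ↔ ∀ a : ℚ, f.coeff a ≠ 0 → ∃ n : ℤ, a = (n : ℚ) / q := by
  have hq' : (0 : ℚ) < q := by positivity
  constructor
  · rintro ⟨g, rfl⟩ a ha
    by_contra hcon
    apply ha
    change (embDomain _ g).coeff a = 0
    apply embDomain_of_notMem_range
    rintro ⟨n, hn⟩
    exact hcon ⟨n, hn.symm⟩
  · intro h
    have hmono : Monotone (fun n : ℤ => (n : ℚ) / q) := by
      intro m n hmn
      have : (m : ℚ) ≤ n := by exact_mod_cast hmn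
      change (m : ℚ) / q ≤ (n : ℚ) / q
      gcongr
    have hinj : ∀ m n : ℤ, (m : ℚ) / q ≤ (n : ℚ) / q → m ≤ n := by
      intro m n hmn
      rw [div_le_div_iff_of_pos_right hq'] at hmn
      exact_mod_cast hmn
    let s : Set ℤ := {n : ℤ | f.coeff ((n : ℚ) / q) ≠ 0}
    have hs : s.IsPWO := by
      intro u
      obtain ⟨m, n, hmn, hle⟩ := f.isPWO_support
        (fun k => ⟨((u k : ℤ) : ℚ) / q, (u k).2⟩)
      exact ⟨m, n, hmn, hinj _ _ hle⟩
    refine ⟨⟨fun n : ℤ => f.coeff ((n : ℚ) / q), hs⟩, ?_⟩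
    ext a
    by_cases ha : ∃ n : ℤ, a = (n : ℚ) / q
    · obtain ⟨n, rfl⟩ := ha
      exact embDomain_coeff (a := n)
    · have h0 : f.coeff a = 0 := by
        by_contra hne
        exact ha (h a hne)
      rw [h0]
      change (embDomain _ _).coeff a = 0
      apply embDomain_of_notMem_range
      rintro ⟨n, hn⟩
      exact ha ⟨n, hn.symm⟩

theorem ramifiedLaurent_le {E : Type*} [Field E] {q q' : ℕ} (hq : 0 < q) (hq' : 0 < q')
    (hd : q ∣ q') : ramifiedLaurent E q hq ≤ ramifiedLaurent E q' hq' := by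
  intro f hf
  rw [mem_ramifiedLaurent_iff] at hf ⊢
  obtain ⟨c, rfl⟩ := hd
  have hc : 0 < c := Nat.pos_of_mul_pos_left hq'
  intro a ha
  obtain ⟨n, rfl⟩ := hf a ha
  refine ⟨n * c, ?_⟩
  have h1 : (q : ℚ) ≠ 0 := by positivity
  have h2 : (c : ℚ) ≠ 0 := by positivity
  push_cast
  field_simp

/-- The field of Puiseux series over `E`, the union of the fields `E((x^{1/q}))`, `q ≥ 1`. -/
def puiseuxField (E : Type*) [Field E] : IntermediateField E (HahnSeries ℚ E) where
  carrier := {f | ∃ (q : ℕ) (hq : 0 < q), f ∈ ramifiedLaurent E q hq}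
  mul_mem' := by
    rintro f g ⟨q, hq, hf⟩ ⟨q', hq', hg⟩
    exact ⟨q * q', Nat.mul_pos hq hq', mul_mem
      (ramifiedLaurent_le hq _ (Dvd.intro _ rfl) hf)
      (ramifiedLaurent_le hq' _ (Dvd.intro_left _ rfl) hg)⟩
  add_mem' := by
    rintro f g ⟨q, hq, hf⟩ ⟨q', hq', hg⟩
    exact ⟨q * q', Nat.mul_pos hq hq', add_mem
      (ramifiedLaurent_le hq _ (Dvd.intro _ rfl) hf)
      (ramifiedLaurent_le hq' _ (Dvd.intro_left _ rfl) hg)⟩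
  algebraMap_mem' := fun c => ⟨1, Nat.one_pos, IntermediateField.algebraMap_mem _ c⟩
  inv_mem' := by
    rintro f ⟨q, hq, hf⟩
    exact ⟨q, hq, inv_mem hf⟩

abbrev Puiseux (E : Type*) [Field E] : Type _ := ↥(puiseuxField E)

/-- The substitution `f(x) ↦ f(x^b)` on series with rational exponents. -/
def mahlerHahn (b : ℕ) [b.AtLeastTwo] (E : Type*) [Field E] :
    HahnSeries ℚ E →ₐ[E] HahnSeries ℚ E :=
  have hb : (0 : ℚ) < b := by
    have := Nat.AtLeastTwo.prop (n := b)
    exact_mod_cast (by omega : 0 < b)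
  embDomainAlgHom
    ({ toFun := fun a => (b : ℚ) * a
       map_zero' := by simp
       map_add' := fun _ _ => by ring } : ℚ →+ ℚ)
    (fun _ _ h => mul_left_cancel₀ hb.ne' h)
    (fun _ _ => mul_le_mul_iff_right₀ hb)

theorem mahlerHahn_mem (b : ℕ) [b.AtLeastTwo] {E : Type*} [Field E] {f : HahnSeries ℚ E}
    (hf : f ∈ puiseuxField E) : mahlerHahn b E f ∈ puiseuxField E := by
  obtain ⟨q, hq, hf⟩ := hf
  refine ⟨q, hq, ?_⟩
  rw [mem_ramifiedLaurent_iff] at hf ⊢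
  intro a ha
  by_cases h : ∃ c : ℚ, (b : ℚ) * c = a
  · obtain ⟨c, rfl⟩ := h
    have hc : (mahlerHahn b E f).coeff ((b : ℚ) * c) = f.coeff c := embDomain_coeff (a := c)
    rw [hc] at ha
    obtain ⟨n, rfl⟩ := hf c ha
    exact ⟨b * n, by push_cast; ring⟩
  · exfalso
    apply ha
    change (embDomain _ f).coeff a = 0
    apply embDomain_of_notMem_range
    rintro ⟨c, hc⟩
    exact h ⟨c, hc⟩

/-- The Mahler operator `M` of radix `b` on Puiseux series. -/
def mahler (b : ℕ) [b.AtLeastTwo] (E : Type*) [Field E] : Puiseux E →ₐ[E] Puiseux E :=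
  ((mahlerHahn b E).comp (puiseuxField E).val).codRestrict (puiseuxField E).toSubalgebra
    (fun f => mahlerHahn_mem b f.2)

/-- The Puiseux series `x`. -/
def puiseuxX (E : Type*) [Field E] : Puiseux E :=
  ⟨single (1 : ℚ) (1 : E), by
    refine ⟨1, Nat.one_pos, ?_⟩
    rw [mem_ramifiedLaurent_iff]
    intro a ha
    refine ⟨1, ?_⟩
    by_contra hne
    apply ha
    apply coeff_single_of_ne
    intro h
    apply hne
    rw [h]
    norm_num⟩

/-- A polynomial over `K` seen as a Puiseux series over an extension `E` of `K`. -/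
def polyToPuiseux (K E : Type*) [Field K] [Field E] [Algebra K E] : K[X] →+* Puiseux E :=
  eval₂RingHom ((algebraMap E (Puiseux E)).comp (algebraMap K E)) (puiseuxX E)

/-! ### The difference ring of generalized series -/

/-- The `Puiseux E`-algebra with basis `e_λ` (`λ` a nonzero element of `E`) and product
`e_λ e_μ = e_{λμ}`, `e_1 = 1`: the group algebra of `Eˣ`. -/
abbrev GenSeries (E : Type*) [Field E] : Type _ := MonoidAlgebra (Puiseux E) Eˣ

/-- The element `e_λ p`. -/
abbrev expTimes {E : Type*} [Field E] (lam : Eˣ) (p : Puiseux E) : GenSeries E :=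
  MonoidAlgebra.single lam p

/-- The Mahler operator on generalized series: it extends the one on Puiseux series and
satisfies `M e_λ = λ e_λ`. -/
def mahlerD (b : ℕ) [b.AtLeastTwo] (E : Type*) [Field E] : GenSeries E →ₐ[E] GenSeries E :=
  MonoidAlgebra.liftNCAlgHom
    ((IsScalarTower.toAlgHom E (Puiseux E) (GenSeries E)).comp (mahler b E))
    ({ toFun := fun lam => expTimes lam (algebraMap E (Puiseux E) lam)
       map_one' := by simp [MonoidAlgebra.one_def]
       map_mul' := fun lam mu => by simp [MonoidAlgebra.single_mul_single] } : Eˣ →* GenSeries E)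
    (fun _ _ => Commute.all _ _)

theorem mahlerD_expTimes (b : ℕ) [b.AtLeastTwo] {E : Type*} [Field E] (lam : Eˣ)
    (p : Puiseux E) :
    mahlerD b E (expTimes lam p) = expTimes lam ((lam : E) • mahler b E p) := by
  simp [mahlerD, MonoidAlgebra.liftNC_single, MonoidAlgebra.single_mul_single,
    Algebra.smul_def, mul_comm]

/-! ### The linear equation and the Riccati equation -/

/-- `L y` for the operator `L = ∑_{k ≤ r} ℓ_k M^k`. -/
def linOp (b : ℕ) [b.AtLeastTwo] {K : Type*} [Field K] {r : ℕ} (l : Fin (r + 1) → K[X])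
    {E : Type*} [Field E] [Algebra K E] (y : GenSeries E) : GenSeries E :=
  ∑ k : Fin (r + 1), polyToPuiseux K E (l k) • (mahlerD b E)^[k] y

/-- The Puiseux series `u` over `E` with `∑_{k ≤ r} ℓ_k u (M u) ⋯ (M^{k-1} u) = 0`. -/
def riccatiSolutions (b : ℕ) [b.AtLeastTwo] {K : Type*} [Field K] {r : ℕ}
    (l : Fin (r + 1) → K[X]) (E : Type*) [Field E] [Algebra K E] : Set (Puiseux E) :=
  {u | ∑ k : Fin (r + 1),
    polyToPuiseux K E (l k) * ∏ i ∈ Finset.range k, (mahler b E)^[i] u = 0}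

/-- `y` is hypergeometric: `M y = u y` for some Puiseux series `u`. -/
def IsHypergeometric (b : ℕ) [b.AtLeastTwo] {E : Type*} [Field E] (y : GenSeries E) : Prop :=
  ∃ u : Puiseux E, mahlerD b E y = u • y

/-- `u = M y / y`. -/
def IsMahlerQuotient (b : ℕ) [b.AtLeastTwo] {E : Type*} [Field E] (u : Puiseux E)
    (y : GenSeries E) : Prop :=
  IsUnit y ∧ mahlerD b E y = u • y

theorem isHypergeometric_expTimes (b : ℕ) [b.AtLeastTwo] {E : Type*} [Field E] (lam : Eˣ)
    (p : Puiseux E) : IsHypergeometric b (expTimes lam p) := by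
  by_cases hp : p = 0
  · exact ⟨0, by simp [hp]⟩
  · refine ⟨((lam : E) • mahler b E p) / p, ?_⟩
    rw [mahlerD_expTimes, MonoidAlgebra.smul_single, smul_eq_mul, div_mul_cancel₀ _ hp]

/-- The `E`-vector space of the hypergeometric solutions of `L y = 0` that lie in
`e_λ Puiseux(E)`. -/
def hypSolutions (b : ℕ) [b.AtLeastTwo] {K : Type*} [Field K] {r : ℕ} (l : Fin (r + 1) → K[X])
    (E : Type*) [Field E] [Algebra K E] (lam : Eˣ) : Submodule E (GenSeries E) where
  carrier := {y | (∃ p : Puiseux E, y = expTimes lam p) ∧ IsHypergeometric b y ∧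
    linOp b l y = 0}
  zero_mem' := ⟨⟨0, by simp⟩, ⟨0, by simp⟩, by simp [linOp]⟩
  add_mem' := by
    rintro _ _ ⟨⟨p, rfl⟩, -, hp⟩ ⟨⟨q, rfl⟩, -, hq⟩
    have h : expTimes lam p + expTimes lam q = expTimes lam (p + q) :=
      (MonoidAlgebra.single_add lam p q).symm
    refine ⟨⟨p + q, h⟩, h ▸ isHypergeometric_expTimes b lam (p + q), ?_⟩
    simp only [linOp, iterate_map_add, smul_add, Finset.sum_add_distrib] at hp hq ⊢
    rw [hp, hq, add_zero]
  smul_mem' := by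
    rintro c _ ⟨⟨p, rfl⟩, -, hp⟩
    have h : c • expTimes lam p = expTimes lam (c • p) := MonoidAlgebra.smul_single c lam p
    refine ⟨⟨c • p, h⟩, h ▸ isHypergeometric_expTimes b lam (c • p), ?_⟩
    have hit : ∀ (n : ℕ) (y : GenSeries E),
        (mahlerD b E)^[n] (c • y) = c • (mahlerD b E)^[n] y := by
      intro n
      induction n with
      | zero => intro y; rfl
      | succ n ih => intro y; simp only [Function.iterate_succ_apply, map_smul, ih]
    have hs : linOp b l (c • expTimes lam p) = c • linOp b l (expTimes lam p) := by
      simp only [linOp, hit, Finset.smul_sum]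
      refine Finset.sum_congr rfl fun k _ => ?_
      rw [← algebraMap_smul (Puiseux E) c, ← algebraMap_smul (Puiseux E) c, smul_smul, smul_smul,
        mul_comm]
    rw [hs, hp, smul_zero]

/-- The set of the quotients `M y / y` for nonzero hypergeometric solutions `y` of `L y = 0` in
`e_λ Puiseux(E)`. -/
def riccatiClass (b : ℕ) [b.AtLeastTwo] {K : Type*} [Field K] {r : ℕ} (l : Fin (r + 1) → K[X])
    (E : Type*) [Field E] [Algebra K E] (lam : Eˣ) : Set (Puiseux E) :=
  {u | ∃ y ∈ hypSolutions b l E lam, y ≠ 0 ∧ IsMahlerQuotient b u y}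

/-! ### The lower Newton polygon -/

/-- The pairs `(k, j)` such that the coefficient of `x^j` in `ℓ_k` is nonzero; the corresponding
point of the plane is `(b^k, j)`. -/
def newtonPoints {K : Type*} [Field K] {r : ℕ} (l : Fin (r + 1) → K[X]) :
    Finset (Σ _ : Fin (r + 1), ℕ) :=
  Finset.univ.sigma fun k => (l k).support

/-- Slope of the line through the points of two index pairs. -/
def edgeSlope (b : ℕ) {r : ℕ} (P Q : Σ _ : Fin (r + 1), ℕ) : ℚ :=
  ((Q.2 : ℚ) - P.2) / ((b : ℚ) ^ (Q.1 : ℕ) - (b : ℚ) ^ (P.1 : ℕ))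

/-- Ordinate at abscissa `b^k` of the line through the points of `P` and `Q`. -/
def lineAt (b : ℕ) {r : ℕ} (P Q : Σ _ : Fin (r + 1), ℕ) (k : Fin (r + 1)) : ℚ :=
  P.2 + edgeSlope b P Q * ((b : ℚ) ^ (k : ℕ) - (b : ℚ) ^ (P.1 : ℕ))

/-- The edges of the lower convex hull of the points `(b^k, j)`, given by their left and right
end points `P`, `Q`: no point lies below the line `PQ`, and the points on this line have abscissae
between those of `P` and `Q`. -/
def lowerEdges (b : ℕ) {K : Type*} [Field K] {r : ℕ} (l : Fin (r + 1) → K[X]) :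
    Finset ((Σ _ : Fin (r + 1), ℕ) × (Σ _ : Fin (r + 1), ℕ)) :=
  open Classical in
  (newtonPoints l ×ˢ newtonPoints l).filter fun e =>
    e.1.1 < e.2.1 ∧ ∀ T ∈ newtonPoints l,
      lineAt b e.1 e.2 T.1 ≤ T.2 ∧
      (lineAt b e.1 e.2 T.1 = T.2 → e.1.1 ≤ T.1 ∧ T.1 ≤ e.2.1)

/-- The characteristic polynomial of an edge with left end point of abscissa `b^{k₁}`: the sum of
`ℓ_{k,j} X^{k - k₁}` over the points `(b^k, j)` on the edge. -/
def charPoly (b : ℕ) {K : Type*} [Field K] {r : ℕ} (l : Fin (r + 1) → K[X])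
    (e : (Σ _ : Fin (r + 1), ℕ) × (Σ _ : Fin (r + 1), ℕ)) : K[X] :=
  open Classical in
  ∑ T ∈ (newtonPoints l).filter
      (fun T => e.1.1 ≤ T.1 ∧ T.1 ≤ e.2.1 ∧ lineAt b e.1 e.2 T.1 = T.2),
    C ((l T.1).coeff T.2) * X ^ ((T.1 : ℕ) - (e.1.1 : ℕ))

/-- The edge `e` is `λ`-admissible. -/
def IsAdmissible (b : ℕ) {K : Type*} [Field K] {r : ℕ} (l : Fin (r + 1) → K[X])
    {E : Type*} [Field E] [Algebra K E] (lam : E)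
    (e : (Σ _ : Fin (r + 1), ℕ) × (Σ _ : Fin (r + 1), ℕ)) : Prop :=
  aeval lam (charPoly b l e) = 0

/-- The set `Λ` of the roots in `E` of the characteristic polynomials of the edges. -/
def charRoots (b : ℕ) {K : Type*} [Field K] {r : ℕ} (l : Fin (r + 1) → K[X])
    (E : Type*) [Field E] [Algebra K E] : Set E :=
  {lam | ∃ e ∈ lowerEdges b l, IsAdmissible b l lam e}

/-- The ramification bound `q_λ`: the lcm of those denominators of slopes of `λ`-admissible edges
that are coprime with `b`. -/
def ramBound (b : ℕ) {K : Type*} [Field K] {r : ℕ} (l : Fin (r + 1) → K[X])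
    {E : Type*} [Field E] [Algebra K E] (lam : E) : ℕ :=
  open Classical in
  ((lowerEdges b l).filter fun e =>
    IsAdmissible b l lam e ∧ Nat.Coprime b (edgeSlope b e.1 e.2).den).lcm
      fun e => (edgeSlope b e.1 e.2).den

theorem ramBound_pos (b : ℕ) {K : Type*} [Field K] {r : ℕ} (l : Fin (r + 1) → K[X])
    {E : Type*} [Field E] [Algebra K E] (lam : E) : 0 < ramBound b l lam := by
  classical
  rw [Nat.pos_iff_ne_zero, ramBound, Ne, Finset.lcm_eq_zero_iff]
  rintro ⟨e, -, he⟩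
  exact (edgeSlope b e.1 e.2).den_nz he

/-- The set `Λ'` of the (necessarily nonzero) `λ ∈ Λ` such that `L y = 0` has a nonzero
solution in `e_λ Puiseux(E)`; it is used with `E` an algebraic closure of `K`. -/
def charRoots' (b : ℕ) [b.AtLeastTwo] {K : Type*} [Field K] {r : ℕ} (l : Fin (r + 1) → K[X])
    (E : Type*) [Field E] [Algebra K E] : Set Eˣ :=
  {lam | (lam : E) ∈ charRoots b l E ∧
    ∃ p : Puiseux E, expTimes lam p ≠ 0 ∧ linOp b l (expTimes lam p) = 0}

/-- The intersection of `Λ'` with an intermediate field `F`. -/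
def charRootsIn (b : ℕ) [b.AtLeastTwo] {K : Type*} [Field K] {r : ℕ} (l : Fin (r + 1) → K[X])
    {Kbar : Type*} [Field Kbar] [Algebra K Kbar] (F : IntermediateField K Kbar) : Set (↥F)ˣ :=
  {lam | Units.map (algebraMap F Kbar : F →* Kbar) lam ∈ charRoots' b l Kbar}

/-! ### Rational maps on a projective space -/

/-- A map `φ` from the projectivization of an `E`-vector space `V` to an extension field `F`
of `E` is rational: in the homogeneous coordinates given by a basis of `V`, it is a quotient of two
homogeneous polynomials of the same degree with coefficients in `F`, the denominator having no zero
on the projectivization. -/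
def IsRationalOnProj {E V F : Type*} [Field E] [AddCommGroup V] [Module E V] [Field F]
    [Algebra E F] (φ : Projectivization E V → F) : Prop :=
  ∀ (n : ℕ) (v : Module.Basis (Fin n) E V), ∃ (d : ℕ) (A B : MvPolynomial (Fin n) F),
    A.IsHomogeneous d ∧ B.IsHomogeneous d ∧
    ∀ (c : Fin n → E) (hc : ∑ i, c i • v i ≠ 0),
      MvPolynomial.eval (fun i => algebraMap E F (c i)) B ≠ 0 ∧
      φ (Projectivization.mk E (∑ i, c i • v i) hc) =
        MvPolynomial.eval (fun i => algebraMap E F (c i)) A /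
          MvPolynomial.eval (fun i => algebraMap E F (c i)) B

end MahlerRiccati

end

/-!
Conjugating `L` by `e_λ` replaces `M` by `λ M`: the solutions `e_λ p` correspond to the solutions
`p` of `∑ ℓ_k (λ M)^k p = 0`. The coefficient of lowest exponent in this equation shows that minus
the order of `p` is the slope of a `λ`-admissible edge.

* A nonzero `u` always has the form `λ M p / p`: if its leading term is `c x^v`, then `λ = c` and
  `p` is `x^{v / (b - 1)}` times a power series computed coefficient by coefficient. The Riccati
  equation for `u` is then the linear equation for `e_λ p`.
* Solving the linear equation for `p` in terms of `M p` shows that the exponents of a solution have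
  denominators coprime with `b`. Multiplication by `x` and `M` then preserve these denominators, so
  the terms of `p` with exponents of a given denominator form a solution too, and this denominator
  is that of an admissible slope.
* A linear form on the coefficients turns a solution over a larger field into one over a smaller
  field that contains `λ`, so whether `L` has a nonzero solution in `e_λ Puiseux` does not depend on
  the field.
* If `M p / p = M q / q`, then `p / q` is fixed by `M`, hence constant, so `[y] ↦ M y / y` is
  injective.
* Linearly independent solutions `e_λ p`, for varying `λ`, number at most `r`: as for a vanishing
  Casoratian, a relation over the Puiseux series between their iterates under `M`, of minimal
  support, has constant coefficients.
-/

noncomputable section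

namespace MahlerRiccati

open HahnSeries Polynomial

theorem one_lt_radix (b : ℕ) [b.AtLeastTwo] : (1 : ℚ) < b := by
  exact_mod_cast Nat.AtLeastTwo.prop (n := b)

theorem radix_ne_zero (b : ℕ) [b.AtLeastTwo] : (b : ℚ) ≠ 0 :=
  (zero_lt_one.trans (one_lt_radix b)).ne'

/-! ### Coefficients, order and leading coefficient of Puiseux series -/

section Coefficients

variable {E : Type*} [Field E]

theorem puiseux_ext {p q : Puiseux E} (h : ∀ a, p.1.coeff a = q.1.coeff a) : p = q :=
  Subtype.ext (HahnSeries.ext (funext h))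

theorem coeff_smul_puiseux (c : E) (p : Puiseux E) (a : ℚ) :
    (c • p).1.coeff a = c * p.1.coeff a :=
  rfl

theorem coeff_algebraMap_puiseux (c : E) (a : ℚ) :
    (algebraMap E (Puiseux E) c).1.coeff a = if a = 0 then c else 0 := by
  split_ifs with ha
  · rw [ha]
    exact coeff_single_same 0 c
  · exact coeff_single_of_ne ha

theorem coeff_order_ne_zero {p : Puiseux E} (hp : p ≠ 0) : p.1.coeff p.1.order ≠ 0 :=
  coeff_order_eq_zero.not.2 (ZeroMemClass.coe_eq_zero.not.2 hp)

theorem leadingCoeff_puiseux_ne_zero {p : Puiseux E} (hp : p ≠ 0) : p.1.leadingCoeff ≠ 0 :=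
  leadingCoeff_ne_zero.2 (ZeroMemClass.coe_eq_zero.not.2 hp)

theorem leadingCoeff_smul_puiseux (c : E) (p : Puiseux E) :
    (c • p).1.leadingCoeff = c * p.1.leadingCoeff := by
  have h : (c • p).1 = HahnSeries.C c * p.1 := by
    rw [C_mul_eq_smul]
    rfl
  rw [h, HahnSeries.leadingCoeff_mul, HahnSeries.C_apply, leadingCoeff_of_single]

theorem coe_polyToPuiseux {K : Type*} [Field K] [Algebra K E] (f : K[X]) :
    (polyToPuiseux K E f).1 = ∑ j ∈ f.support, single (j : ℚ) (algebraMap K E (f.coeff j)) := by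
  change (puiseuxField E).val (eval₂ _ _ f) = _
  rw [eval₂_def, Polynomial.sum, map_sum]
  refine Finset.sum_congr rfl fun j _ => ?_
  have hX : (puiseuxField E).val (puiseuxX E) = single (1 : ℚ) (1 : E) := rfl
  have hC : (puiseuxField E).val (algebraMap E (Puiseux E) (algebraMap K E (f.coeff j))) =
      single (0 : ℚ) (algebraMap K E (f.coeff j)) := rfl
  rw [map_mul, map_pow, hX, RingHom.comp_apply, hC, single_pow, single_mul_single]
  simp

theorem coeff_polyToPuiseux_mul {K : Type*} [Field K] [Algebra K E] (f : K[X]) (p : Puiseux E)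
    (a : ℚ) :
    (polyToPuiseux K E f * p).1.coeff a =
      ∑ j ∈ f.support, algebraMap K E (f.coeff j) * p.1.coeff (a - j) := by
  rw [MulMemClass.coe_mul, coe_polyToPuiseux, Finset.sum_mul, HahnSeries.coeff_sum]
  exact Finset.sum_congr rfl fun j _ => coeff_single_mul

theorem polyToPuiseux_injective {K : Type*} [Field K] [Algebra K E] :
    Function.Injective (polyToPuiseux K E) := by
  refine (injective_iff_map_eq_zero _).2 fun f hf => ?_
  ext j
  have h : (polyToPuiseux K E f * 1).1.coeff j = 0 := by
    rw [hf, zero_mul]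
    rfl
  rw [coeff_polyToPuiseux_mul] at h
  simpa [HahnSeries.coeff_one, sub_eq_zero] using h

end Coefficients

section Mahler

variable (b : ℕ) [b.AtLeastTwo] {E : Type*} [Field E]

theorem coeff_mahler_mul (p : Puiseux E) (a : ℚ) :
    (mahler b E p).1.coeff (b * a) = p.1.coeff a :=
  embDomain_coeff (a := a)

theorem coeff_mahler (p : Puiseux E) (a : ℚ) :
    (mahler b E p).1.coeff a = p.1.coeff (a / b) := by
  rw [← coeff_mahler_mul b p, mul_div_cancel₀ _ (radix_ne_zero b)]

theorem coeff_mahler_iterate (k : ℕ) (p : Puiseux E) (a : ℚ) :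
    ((mahler b E)^[k] p).1.coeff a = p.1.coeff (a / (b : ℚ) ^ k) := by
  induction k generalizing p with
  | zero => simp
  | succ k ih => rw [Function.iterate_succ_apply, ih, coeff_mahler, div_div, pow_succ]

theorem order_mahler (p : Puiseux E) : (mahler b E p).1.order = b * p.1.order := by
  obtain rfl | hp := eq_or_ne p 0
  · simp
  have hMp : mahler b E p ≠ 0 := (_root_.map_ne_zero _).2 hp
  apply le_antisymm
  · refine order_le_of_coeff_ne_zero ?_
    rw [coeff_mahler_mul]
    exact coeff_order_ne_zero hp
  · have h := coeff_order_ne_zero hMp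
    rw [coeff_mahler] at h
    rw [← le_div_iff₀' (zero_lt_one.trans (one_lt_radix b))]
    exact order_le_of_coeff_ne_zero h

theorem leadingCoeff_mahler (p : Puiseux E) :
    (mahler b E p).1.leadingCoeff = p.1.leadingCoeff := by
  rw [leadingCoeff_eq, leadingCoeff_eq, order_mahler, coeff_mahler_mul]

/-- Comparing leading coefficients shows `μ = 1`; comparing orders, also after subtracting the
constant coefficient, shows that a fixed point of `M` is constant. -/
theorem exists_const_of_mahler_eq_smul {mu : E} {c : Puiseux E} (hc : c ≠ 0)
    (h : mahler b E c = mu • c) : mu = 1 ∧ ∃ c₀ : E, c = algebraMap E (Puiseux E) c₀ := by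
  have hmu : mu = 1 := by
    have h' := congrArg (fun p : Puiseux E => p.1.leadingCoeff) h
    simp only [leadingCoeff_mahler, leadingCoeff_smul_puiseux] at h'
    exact (mul_eq_right₀ (leadingCoeff_puiseux_ne_zero hc)).1 h'.symm
  refine ⟨hmu, c.1.coeff 0, ?_⟩
  set d := c - algebraMap E (Puiseux E) (c.1.coeff 0) with hd
  have hfix : mahler b E d = d := by
    rw [hd, map_sub, AlgHom.commutes, h, hmu, one_smul]
  have hord : d.1.order = 0 := by
    have h' := order_mahler b d
    rw [hfix] at h'
    have hb := one_lt_radix b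
    nlinarith
  by_contra hne
  have hcoeff := coeff_order_ne_zero (sub_ne_zero.2 hne)
  rw [← hd, hord] at hcoeff
  refine hcoeff ?_
  change c.1.coeff 0 - (algebraMap E (Puiseux E) (c.1.coeff 0)).1.coeff 0 = 0
  rw [coeff_algebraMap_puiseux, if_pos rfl, sub_self]

end Mahler

section TwistedOperator

variable (b : ℕ) [b.AtLeastTwo] {E : Type*} [Field E]

/-- The operator `λ M = e_λ⁻¹ M e_λ` on Puiseux series. -/
def twistedMahler (lam : E) : Module.End E (Puiseux E) :=
  lam • (mahler b E).toLinearMap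

theorem twistedMahler_apply (lam : E) (p : Puiseux E) :
    twistedMahler b lam p = lam • mahler b E p :=
  rfl

theorem twistedMahler_mul (lam : E) (u p : Puiseux E) :
    twistedMahler b lam (u * p) = mahler b E u * twistedMahler b lam p := by
  rw [twistedMahler_apply, twistedMahler_apply, map_mul, mul_smul_comm]

theorem twistedMahler_pow_apply (lam : E) (k : ℕ) (p : Puiseux E) :
    (twistedMahler b lam ^ k) p = lam ^ k • (mahler b E)^[k] p := by
  rw [twistedMahler, _root_.smul_pow, LinearMap.smul_apply, Module.End.pow_apply]
  rfl

theorem coeff_twistedMahler_pow (lam : E) (k : ℕ) (p : Puiseux E) (a : ℚ) :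
    ((twistedMahler b lam ^ k) p).1.coeff a = lam ^ k * p.1.coeff (a / (b : ℚ) ^ k) := by
  rw [twistedMahler_pow_apply, coeff_smul_puiseux, coeff_mahler_iterate]

theorem mahlerD_iterate_expTimes (lam : Eˣ) (k : ℕ) (p : Puiseux E) :
    (mahlerD b E)^[k] (expTimes lam p) = expTimes lam ((twistedMahler b (lam : E) ^ k) p) := by
  rw [Module.End.pow_apply]
  have h : Function.Semiconj (expTimes lam) (twistedMahler b (lam : E)) (mahlerD b E) :=
    fun q => (mahlerD_expTimes b lam q).symm
  exact ((h.iterate_right k).eq p).symm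

variable {K : Type*} [Field K] [Algebra K E] {r : ℕ} (l : Fin (r + 1) → K[X])

/-- The operator `e_λ⁻¹ L e_λ = ∑ ℓ_k (λ M)^k` on Puiseux series. -/
def twistedOp (lam : E) : Puiseux E →ₗ[E] Puiseux E :=
  ∑ k : Fin (r + 1), LinearMap.mulLeft E (polyToPuiseux K E (l k)) ∘ₗ twistedMahler b lam ^ (k : ℕ)

theorem twistedOp_apply (lam : E) (p : Puiseux E) :
    twistedOp b l lam p =
      ∑ k : Fin (r + 1), polyToPuiseux K E (l k) * (twistedMahler b lam ^ (k : ℕ)) p := by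
  simp [twistedOp]

theorem linOp_expTimes (lam : Eˣ) (p : Puiseux E) :
    linOp b l (expTimes lam p) = expTimes lam (twistedOp b l (lam : E) p) := by
  simp only [linOp, mahlerD_iterate_expTimes, MonoidAlgebra.smul_single, smul_eq_mul,
    twistedOp_apply]
  exact (map_sum (MonoidAlgebra.singleAddHom lam) _ _).symm

theorem coeff_twistedOp (lam : E) (p : Puiseux E) (a : ℚ) :
    (twistedOp b l lam p).1.coeff a =
      ∑ T ∈ newtonPoints l, lam ^ (T.1 : ℕ) * algebraMap K E ((l T.1).coeff T.2) *
        p.1.coeff ((a - T.2) / (b : ℚ) ^ (T.1 : ℕ)) := by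
  have hsum : (twistedOp b l lam p).1 =
      ∑ k : Fin (r + 1), (polyToPuiseux K E (l k) * (twistedMahler b lam ^ (k : ℕ)) p).1 := by
    rw [twistedOp_apply]
    exact map_sum (puiseuxField E).val _ _
  rw [hsum, HahnSeries.coeff_sum, newtonPoints, Finset.sum_sigma]
  refine Finset.sum_congr rfl fun k _ => ?_
  rw [coeff_polyToPuiseux_mul]
  refine Finset.sum_congr rfl fun j _ => ?_
  rw [coeff_twistedMahler_pow]
  ring

theorem mem_hypSolutions {lam : Eˣ} {y : GenSeries E} :
    y ∈ hypSolutions b l E lam ↔ ∃ p, twistedOp b l (lam : E) p = 0 ∧ expTimes lam p = y := by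
  constructor
  · rintro ⟨⟨p, rfl⟩, -, hp⟩
    rw [linOp_expTimes, MonoidAlgebra.single_eq_zero] at hp
    exact ⟨p, hp, rfl⟩
  · rintro ⟨p, hp, rfl⟩
    exact ⟨⟨p, rfl⟩, isHypergeometric_expTimes b lam p,
      by rw [linOp_expTimes, hp, expTimes, MonoidAlgebra.single_zero]⟩

/-- The coefficient of `e_λ` identifies hypergeometric solutions with solutions of the twisted
equation. -/
def hypSolutionsEquiv (lam : Eˣ) :
    LinearMap.ker (twistedOp b l (lam : E)) ≃ₗ[E] hypSolutions b l E lam :=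
  (Submodule.equivMapOfInjective (MonoidAlgebra.lsingle lam)
    (fun _ _ => MonoidAlgebra.single_right_inj.1)
    (LinearMap.ker (twistedOp b l (lam : E)))).trans
  (LinearEquiv.ofEq _ _ <| by
    ext y
    rw [mem_hypSolutions]
    rfl)

theorem hypSolutions_ne_bot_iff {lam : Eˣ} :
    hypSolutions b l E lam ≠ ⊥ ↔ ∃ p ≠ 0, twistedOp b l (lam : E) p = 0 := by
  rw [Submodule.ne_bot_iff]
  constructor
  · rintro ⟨y, hy, hne⟩
    obtain ⟨p, hp, rfl⟩ := (mem_hypSolutions b l).1 hy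
    exact ⟨p, MonoidAlgebra.single_eq_zero.not.1 hne, hp⟩
  · rintro ⟨p, hne, hp⟩
    exact ⟨expTimes lam p, (mem_hypSolutions b l).2 ⟨p, hp, rfl⟩,
      MonoidAlgebra.single_eq_zero.not.2 hne⟩

end TwistedOperator

section NewtonPolygon

variable (b : ℕ) {K : Type*} [Field K] {r : ℕ} (l : Fin (r + 1) → K[X]) (v : ℚ)

/-- The exponent `j + b ^ k v` that the term `x ^ j M ^ k` of `L` gives to the monomial `x ^ v`. -/
def termExponent (T : Σ _ : Fin (r + 1), ℕ) : ℚ :=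
  T.2 + v * (b : ℚ) ^ (T.1 : ℕ)

/-- The face of the lower Newton polygon on the supporting line of slope `-v`, given by its points:
the terms of `L` that map `x ^ v` to the smallest possible exponent. -/
def newtonFace : Finset (Σ _ : Fin (r + 1), ℕ) :=
  open Classical in
  (newtonPoints l).filter fun T =>
    ∀ T' ∈ newtonPoints l, termExponent b v T ≤ termExponent b v T'

variable {b l v}

theorem mem_newtonPoints {T : Σ _ : Fin (r + 1), ℕ} :
    T ∈ newtonPoints l ↔ (l T.1).coeff T.2 ≠ 0 := by
  simp [newtonPoints]

theorem mem_newtonFace {T : Σ _ : Fin (r + 1), ℕ} :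
    T ∈ newtonFace b l v ↔
      T ∈ newtonPoints l ∧ ∀ T' ∈ newtonPoints l, termExponent b v T ≤ termExponent b v T' := by
  classical
  exact Finset.mem_filter

theorem newtonFace_subset : newtonFace b l v ⊆ newtonPoints l :=
  fun _ hT => (mem_newtonFace.1 hT).1

theorem newtonFace_nonempty (h0 : l 0 ≠ 0) : (newtonFace b l v).Nonempty := by
  obtain ⟨j, hj⟩ := Polynomial.support_nonempty.2 h0
  have hne : (newtonPoints l).Nonempty :=
    ⟨⟨0, j⟩, mem_newtonPoints.2 (Polynomial.mem_support_iff.1 hj)⟩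
  obtain ⟨T, hT, hmin⟩ := Finset.exists_min_image (newtonPoints l) (termExponent b v) hne
  exact ⟨T, mem_newtonFace.2 ⟨hT, hmin⟩⟩

theorem termExponent_eq_of_mem_newtonFace {T T' : Σ _ : Fin (r + 1), ℕ}
    (hT : T ∈ newtonFace b l v) (hT' : T' ∈ newtonFace b l v) :
    termExponent b v T = termExponent b v T' :=
  le_antisymm ((mem_newtonFace.1 hT).2 T' (mem_newtonFace.1 hT').1)
    ((mem_newtonFace.1 hT').2 T (newtonFace_subset hT))

theorem mem_newtonFace_iff_of_mem {P T : Σ _ : Fin (r + 1), ℕ} (hP : P ∈ newtonFace b l v)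
    (hT : T ∈ newtonPoints l) :
    T ∈ newtonFace b l v ↔ termExponent b v T = termExponent b v P :=
  ⟨fun h => termExponent_eq_of_mem_newtonFace h hP,
    fun h => mem_newtonFace.2 ⟨hT, fun T' hT' => h.trans_le ((mem_newtonFace.1 hP).2 T' hT')⟩⟩

theorem eq_of_mem_newtonFace_of_fst_eq {P Q : Σ _ : Fin (r + 1), ℕ} (hP : P ∈ newtonFace b l v)
    (hQ : Q ∈ newtonFace b l v) (h : P.1 = Q.1) : P = Q := by
  have hexp := termExponent_eq_of_mem_newtonFace hP hQ
  rw [termExponent, termExponent, h, add_left_inj, Nat.cast_inj] at hexp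
  exact Sigma.ext h (heq_of_eq hexp)

section Edge

variable [b.AtLeastTwo] {P Q : Σ _ : Fin (r + 1), ℕ}

theorem edgeSlope_of_mem_newtonFace (hP : P ∈ newtonFace b l v) (hQ : Q ∈ newtonFace b l v)
    (hlt : P.1 < Q.1) : edgeSlope b P Q = -v := by
  have hpow : (b : ℚ) ^ (P.1 : ℕ) < (b : ℚ) ^ (Q.1 : ℕ) := pow_lt_pow_right₀ (one_lt_radix b) hlt
  have hexp := termExponent_eq_of_mem_newtonFace hP hQ
  simp only [termExponent] at hexp
  rw [edgeSlope, div_eq_iff (by linarith)]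
  linarith

theorem lineAt_of_mem_newtonFace (hP : P ∈ newtonFace b l v) (hQ : Q ∈ newtonFace b l v)
    (hlt : P.1 < Q.1) (k : Fin (r + 1)) :
    lineAt b P Q k = termExponent b v P - v * (b : ℚ) ^ (k : ℕ) := by
  rw [lineAt, edgeSlope_of_mem_newtonFace hP hQ hlt, termExponent]
  ring

theorem lineAt_eq_iff_mem_newtonFace (hP : P ∈ newtonFace b l v) (hQ : Q ∈ newtonFace b l v)
    (hlt : P.1 < Q.1) {T : Σ _ : Fin (r + 1), ℕ} (hT : T ∈ newtonPoints l) :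
    lineAt b P Q T.1 = T.2 ↔ T ∈ newtonFace b l v := by
  rw [lineAt_of_mem_newtonFace hP hQ hlt, mem_newtonFace_iff_of_mem hP hT, sub_eq_iff_eq_add,
    eq_comm]
  rfl

theorem mem_lowerEdges_of_newtonFace (hP : P ∈ newtonFace b l v) (hQ : Q ∈ newtonFace b l v)
    (hlt : P.1 < Q.1) (hPQ : ∀ T ∈ newtonFace b l v, P.1 ≤ T.1 ∧ T.1 ≤ Q.1) :
    (P, Q) ∈ lowerEdges b l := by
  classical
  refine Finset.mem_filter.2
    ⟨Finset.mem_product.2 ⟨newtonFace_subset hP, newtonFace_subset hQ⟩, hlt,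
      fun T hT => ⟨?_, fun h => hPQ T ((lineAt_eq_iff_mem_newtonFace hP hQ hlt hT).1 h)⟩⟩
  rw [lineAt_of_mem_newtonFace hP hQ hlt, sub_le_iff_le_add]
  exact (mem_newtonFace.1 hP).2 T hT

theorem charPoly_of_newtonFace (hP : P ∈ newtonFace b l v) (hQ : Q ∈ newtonFace b l v)
    (hlt : P.1 < Q.1) (hPQ : ∀ T ∈ newtonFace b l v, P.1 ≤ T.1 ∧ T.1 ≤ Q.1) :
    charPoly b l (P, Q) =
      ∑ T ∈ newtonFace b l v, C ((l T.1).coeff T.2) * X ^ ((T.1 : ℕ) - (P.1 : ℕ)) := by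
  classical
  rw [charPoly]
  refine Finset.sum_congr (Finset.ext fun T => ?_) fun _ _ => rfl
  rw [Finset.mem_filter]
  constructor
  · rintro ⟨hT, -, -, h⟩
    exact (lineAt_eq_iff_mem_newtonFace hP hQ hlt hT).1 h
  · intro hT
    have hT' := newtonFace_subset hT
    exact ⟨hT', (hPQ T hT).1, (hPQ T hT).2, (lineAt_eq_iff_mem_newtonFace hP hQ hlt hT').2 hT⟩

end Edge

variable {E : Type*} [Field E] [Algebra K E] {lam : E}

theorem exists_fst_lt_of_sum_newtonFace_eq_zero (h0 : l 0 ≠ 0) (hlam : lam ≠ 0)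
    (hsum : ∑ T ∈ newtonFace b l v, lam ^ (T.1 : ℕ) * algebraMap K E ((l T.1).coeff T.2) = 0) :
    ∃ P ∈ newtonFace b l v, ∃ Q ∈ newtonFace b l v,
      P.1 < Q.1 ∧ ∀ T ∈ newtonFace b l v, P.1 ≤ T.1 ∧ T.1 ≤ Q.1 := by
  have hne : (newtonFace b l v).Nonempty := newtonFace_nonempty h0
  obtain ⟨P, hP, hPmin⟩ := Finset.exists_min_image (newtonFace b l v) Sigma.fst hne
  obtain ⟨Q, hQ, hQmax⟩ := Finset.exists_max_image (newtonFace b l v) Sigma.fst hne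
  refine ⟨P, hP, Q, hQ, (hPmin Q hQ).lt_of_ne fun heq => ?_, fun T hT => ⟨hPmin T hT, hQmax T hT⟩⟩
  have hface : newtonFace b l v = {P} :=
    Finset.eq_singleton_iff_unique_mem.2 ⟨hP, fun T hT => eq_of_mem_newtonFace_of_fst_eq hT hP
      (le_antisymm ((hQmax T hT).trans heq.ge) (hPmin T hT))⟩
  rw [hface, Finset.sum_singleton] at hsum
  exact mul_ne_zero (pow_ne_zero _ hlam)
    ((_root_.map_ne_zero _).2 (mem_newtonPoints.1 (newtonFace_subset hP))) hsum

variable [b.AtLeastTwo]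

/-- This is the coefficient in `e_λ⁻¹ L e_λ p = 0` of the smallest exponent that can occur. -/
theorem sum_newtonFace_eq_zero {p : Puiseux E} (hne : p ≠ 0) (hp : twistedOp b l lam p = 0) :
    ∑ T ∈ newtonFace b l p.1.order,
      lam ^ (T.1 : ℕ) * algebraMap K E ((l T.1).coeff T.2) = 0 := by
  obtain hempty | ⟨P, hP⟩ := (newtonFace b l p.1.order).eq_empty_or_nonempty
  · rw [hempty, Finset.sum_empty]
  have hpos (k : ℕ) : (0 : ℚ) < (b : ℚ) ^ k := pow_pos (zero_lt_one.trans (one_lt_radix b)) k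
  have hface : ∀ T ∈ newtonFace b l p.1.order,
      p.1.coeff ((termExponent b p.1.order P - T.2) / (b : ℚ) ^ (T.1 : ℕ)) =
        p.1.coeff p.1.order := by
    intro T hT
    rw [termExponent_eq_of_mem_newtonFace hP hT, termExponent, add_sub_cancel_left,
      mul_div_cancel_right₀ _ (hpos _).ne']
  have hoff : ∀ T ∈ newtonPoints l, T ∉ newtonFace b l p.1.order →
      p.1.coeff ((termExponent b p.1.order P - T.2) / (b : ℚ) ^ (T.1 : ℕ)) = 0 := by
    intro T hT hTface
    have hlt : termExponent b p.1.order P < termExponent b p.1.order T :=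
      ((mem_newtonFace.1 hP).2 T hT).lt_of_ne
        fun h => hTface ((mem_newtonFace_iff_of_mem hP hT).2 h.symm)
    refine coeff_eq_zero_of_lt_order ((div_lt_iff₀ (hpos _)).2 ?_)
    rw [sub_lt_iff_lt_add']
    exact hlt
  refine (mul_eq_zero.1 ?_).resolve_right (coeff_order_ne_zero hne)
  calc (∑ T ∈ newtonFace b l p.1.order, lam ^ (T.1 : ℕ) * algebraMap K E ((l T.1).coeff T.2)) *
        p.1.coeff p.1.order
      = (twistedOp b l lam p).1.coeff (termExponent b p.1.order P) := by
        rw [coeff_twistedOp, Finset.sum_mul]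
        refine Finset.sum_subset_zero_on_sdiff newtonFace_subset (fun T hT => ?_) fun T hT => ?_
        · rw [hoff T (Finset.mem_sdiff.1 hT).1 (Finset.mem_sdiff.1 hT).2, mul_zero]
        · rw [hface T hT]
    _ = 0 := by rw [hp]; rfl

theorem exists_admissible_edge (h0 : l 0 ≠ 0) (hlam : lam ≠ 0) {p : Puiseux E} (hne : p ≠ 0)
    (hp : twistedOp b l lam p = 0) :
    ∃ e ∈ lowerEdges b l, IsAdmissible b l lam e ∧ edgeSlope b e.1 e.2 = -p.1.order := by
  have hsum := sum_newtonFace_eq_zero hne hp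
  obtain ⟨P, hP, Q, hQ, hlt, hPQ⟩ := exists_fst_lt_of_sum_newtonFace_eq_zero h0 hlam hsum
  refine ⟨(P, Q), mem_lowerEdges_of_newtonFace hP hQ hlt hPQ, ?_,
    edgeSlope_of_mem_newtonFace hP hQ hlt⟩
  refine (mul_eq_zero.1 ?_).resolve_left (pow_ne_zero (P.1 : ℕ) hlam)
  rw [charPoly_of_newtonFace hP hQ hlt hPQ, map_sum, Finset.mul_sum, ← hsum]
  refine Finset.sum_congr rfl fun T hT => ?_
  rw [map_mul, aeval_C, map_pow, aeval_X, mul_left_comm, ← _root_.pow_add,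
    Nat.add_sub_cancel' (hPQ T hT).1, mul_comm]

end NewtonPolygon

section Exponents

variable {E : Type*} [Field E] {q : ℕ} (hq : 0 < q)

theorem polyToPuiseux_mem_ramifiedLaurent {K : Type*} [Field K] [Algebra K E] (f : K[X]) :
    (polyToPuiseux K E f).1 ∈ ramifiedLaurent E q hq := by
  rw [coe_polyToPuiseux]
  refine sum_mem fun j _ => (mem_ramifiedLaurent_iff hq _).2 fun a ha => ⟨j * q, ?_⟩
  have hq0 : (q : ℚ) ≠ 0 := Nat.cast_ne_zero.2 hq.ne'
  have haj : a = j := by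
    by_contra hne
    exact ha (coeff_single_of_ne hne)
  push_cast
  rw [haj, mul_div_cancel_right₀ _ hq0]

variable (b : ℕ) [b.AtLeastTwo]

theorem mahler_mem_ramifiedLaurent_div_gcd {p : Puiseux E} (hp : p.1 ∈ ramifiedLaurent E q hq) :
    (mahler b E p).1 ∈ ramifiedLaurent E (q / b.gcd q) (Nat.div_gcd_pos_of_pos_right b hq) := by
  refine (mem_ramifiedLaurent_iff _ _).2 fun a ha => ?_
  rw [coeff_mahler] at ha
  obtain ⟨n, hn⟩ := (mem_ramifiedLaurent_iff hq _).1 hp _ ha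
  have hg : (b.gcd q : ℚ) ≠ 0 := Nat.cast_ne_zero.2 (Nat.gcd_pos_of_pos_right b hq).ne'
  have hq0 : (q : ℚ) ≠ 0 := Nat.cast_ne_zero.2 hq.ne'
  refine ⟨n * (b / b.gcd q : ℕ), ?_⟩
  rw [div_eq_iff (radix_ne_zero b)] at hn
  rw [hn, Int.cast_mul, Int.cast_natCast, Nat.cast_div (Nat.gcd_dvd_left b q) hg,
    Nat.cast_div (Nat.gcd_dvd_right b q) hg]
  field_simp

theorem mahler_mem_ramifiedLaurent {p : Puiseux E} (hp : p.1 ∈ ramifiedLaurent E q hq) :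
    (mahler b E p).1 ∈ ramifiedLaurent E q hq :=
  ramifiedLaurent_le _ hq (Nat.div_dvd_of_dvd (Nat.gcd_dvd_right b q))
    (mahler_mem_ramifiedLaurent_div_gcd hq b hp)

theorem smul_mem_ramifiedLaurent (c : E) {p : Puiseux E} (hp : p.1 ∈ ramifiedLaurent E q hq) :
    (c • p).1 ∈ ramifiedLaurent E q hq :=
  (ramifiedLaurent E q hq).smul_mem hp

theorem twistedMahler_pow_mem_ramifiedLaurent (lam : E) (k : ℕ) {p : Puiseux E}
    (hp : p.1 ∈ ramifiedLaurent E q hq) :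
    ((twistedMahler b lam ^ k) p).1 ∈ ramifiedLaurent E q hq := by
  induction k with
  | zero => exact hp
  | succ k ih =>
    rw [pow_succ', Module.End.mul_apply]
    exact smul_mem_ramifiedLaurent hq lam (mahler_mem_ramifiedLaurent hq b ih)

variable {K : Type*} [Field K] [Algebra K E] {r : ℕ} {l : Fin (r + 1) → K[X]} {lam : E}
  {p : Puiseux E} {b}

/-- Solve the equation for `p`: all other terms involve `M p`, whose exponents are multiples
of `b / q`. -/
theorem mem_ramifiedLaurent_div_gcd_of_twistedOp_eq_zero (h0 : l 0 ≠ 0)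
    (hp : twistedOp b l lam p = 0) (hpq : p.1 ∈ ramifiedLaurent E q hq) :
    p.1 ∈ ramifiedLaurent E (q / b.gcd q) (Nat.div_gcd_pos_of_pos_right b hq) := by
  have hl : polyToPuiseux K E (l 0) ≠ 0 := (map_ne_zero_iff _ polyToPuiseux_injective).2 h0
  have hsolve : p = -(polyToPuiseux K E (l 0))⁻¹ * ∑ k : Fin r, polyToPuiseux K E (l k.succ) *
      (twistedMahler b lam ^ (k : ℕ)) (twistedMahler b lam p) := by
    rw [twistedOp_apply, Fin.sum_univ_succ, add_comm, add_eq_zero_iff_eq_neg] at hp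
    simp only [Fin.val_succ, pow_succ, Module.End.mul_apply, Fin.val_zero, pow_zero,
      Module.End.one_apply] at hp
    rw [hp, neg_mul_neg, inv_mul_cancel_left₀ hl]
  have hMp := smul_mem_ramifiedLaurent _ lam (mahler_mem_ramifiedLaurent_div_gcd hq b hpq)
  rw [hsolve]
  refine mul_mem (neg_mem (inv_mem (polyToPuiseux_mem_ramifiedLaurent _ _))) ?_
  have hsum := map_sum (puiseuxField E).val (fun k : Fin r => polyToPuiseux K E (l k.succ) *
      (twistedMahler b lam ^ (k : ℕ)) (twistedMahler b lam p)) Finset.univ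
  rw [IntermediateField.coe_val] at hsum
  rw [hsum]
  exact sum_mem fun k _ => mul_mem (polyToPuiseux_mem_ramifiedLaurent _ _)
    (twistedMahler_pow_mem_ramifiedLaurent _ b lam k hMp)

theorem exists_coprime_mem_ramifiedLaurent (h0 : l 0 ≠ 0) (hp : twistedOp b l lam p = 0) :
    ∃ (q : ℕ) (hq : 0 < q), Nat.Coprime b q ∧ p.1 ∈ ramifiedLaurent E q hq := by
  classical
  have hex : ∃ q : ℕ, ∃ hq : 0 < q, p.1 ∈ ramifiedLaurent E q hq := p.2
  obtain ⟨hq, hpq⟩ := Nat.find_spec hex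
  refine ⟨Nat.find hex, hq, ?_, hpq⟩
  by_contra hg
  have hlt : Nat.find hex / b.gcd (Nat.find hex) < Nat.find hex :=
    Nat.div_lt_self hq (lt_of_le_of_ne' (Nat.gcd_pos_of_pos_right b hq) hg)
  exact Nat.find_min hex hlt
    ⟨_, mem_ramifiedLaurent_div_gcd_of_twistedOp_eq_zero hq h0 hp hpq⟩

end Exponents

section Restrict

variable {E : Type*} [Field E]

theorem mem_puiseuxField_of_support_subset {E' : Type*} [Field E'] {f : HahnSeries ℚ E}
    {p : Puiseux E'} (h : f.support ⊆ p.1.support) : f ∈ puiseuxField E := by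
  obtain ⟨q, hq, hp⟩ := p.2
  exact ⟨q, hq, (mem_ramifiedLaurent_iff hq f).2 fun a ha =>
    (mem_ramifiedLaurent_iff hq p.1).1 hp a (h ha)⟩

/-- The part of a Puiseux series with exponents in `S`. -/
def restrictExponents (S : Set ℚ) (p : Puiseux E) : Puiseux E :=
  have hsub : (S.indicator p.1.coeff).support ⊆ p.1.support := by
    rw [Set.support_indicator]
    exact Set.inter_subset_right
  ⟨⟨S.indicator p.1.coeff, p.1.isPWO_support.mono hsub⟩, mem_puiseuxField_of_support_subset hsub⟩

theorem coeff_restrictExponents (S : Set ℚ) (p : Puiseux E) (a : ℚ) :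
    (restrictExponents S p).1.coeff a = S.indicator p.1.coeff a :=
  rfl

theorem restrictExponents_ne_zero {S : Set ℚ} {p : Puiseux E} {a : ℚ} (haS : a ∈ S)
    (ha : p.1.coeff a ≠ 0) : restrictExponents S p ≠ 0 := by
  intro h
  have hcoeff : (restrictExponents S p).1.coeff a = 0 := by
    rw [h]
    rfl
  rw [coeff_restrictExponents, Set.indicator_of_mem haS] at hcoeff
  exact ha hcoeff

theorem order_restrictExponents_mem {S : Set ℚ} {p : Puiseux E} (h : restrictExponents S p ≠ 0) :
    (restrictExponents S p).1.order ∈ S :=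
  Set.mem_of_indicator_ne_zero (coeff_order_ne_zero h)

variable (b : ℕ) [b.AtLeastTwo] {K : Type*} [Field K] [Algebra K E] {r : ℕ}
  (l : Fin (r + 1) → K[X])

theorem twistedOp_restrictExponents {S : Set ℚ} {p : Puiseux E}
    (hS : ∀ c, p.1.coeff c ≠ 0 → ∀ k j : ℕ, (b : ℚ) ^ k * c + j ∈ S ↔ c ∈ S) (lam : E) :
    twistedOp b l lam (restrictExponents S p) = restrictExponents S (twistedOp b l lam p) := by
  classical
  refine puiseux_ext fun a => ?_
  have hterm (k j : ℕ) :
      (restrictExponents S p).1.coeff ((a - j) / (b : ℚ) ^ k) =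
        if a ∈ S then p.1.coeff ((a - j) / (b : ℚ) ^ k) else 0 := by
    by_cases hc : p.1.coeff ((a - j) / (b : ℚ) ^ k) = 0
    · rw [hc, ite_self, coeff_restrictExponents, Set.indicator_apply_eq_zero]
      exact fun _ => hc
    · have hmem := hS _ hc k j
      rw [mul_div_cancel₀ _ (pow_ne_zero _ (radix_ne_zero b)), sub_add_cancel] at hmem
      rw [coeff_restrictExponents, Set.indicator_apply, hmem]
  rw [coeff_restrictExponents, Set.indicator_apply, coeff_twistedOp, coeff_twistedOp]
  simp only [hterm]
  split_ifs
  · rfl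
  · simp only [mul_zero, Finset.sum_const_zero]

end Restrict

section Ramification

theorem den_pow_mul_add {b : ℕ} {c : ℚ} (hc : Nat.Coprime b c.den) (k j : ℕ) :
    ((b : ℚ) ^ k * c + j).den = c.den := by
  have hcop : Nat.Coprime (((b ^ k : ℕ) : ℤ) * c.num).natAbs c.den := by
    rw [Int.natAbs_mul, Int.natAbs_natCast]
    exact (hc.pow_left k).mul_left c.reduced
  rw [Rat.add_natCast_den, ← Nat.cast_pow, Rat.mul_den, Rat.den_natCast, Rat.num_natCast, one_mul,
    hcop.gcd_eq_one, Nat.div_one]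

variable {b : ℕ} [b.AtLeastTwo] {K : Type*} [Field K] {r : ℕ} {l : Fin (r + 1) → K[X]}
  {E : Type*} [Field E] [Algebra K E] {lam : E} {p : Puiseux E}

theorem coprime_den_of_coeff_ne_zero (h0 : l 0 ≠ 0) (hp : twistedOp b l lam p = 0) {a : ℚ}
    (ha : p.1.coeff a ≠ 0) : Nat.Coprime b a.den := by
  obtain ⟨q, hq, hqb, hpq⟩ := exists_coprime_mem_ramifiedLaurent h0 hp
  obtain ⟨n, rfl⟩ := (mem_ramifiedLaurent_iff hq _).1 hpq a ha
  refine hqb.coprime_dvd_right ?_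
  have hdvd := Rat.den_dvd n q
  rw [Rat.divInt_eq_div] at hdvd
  exact_mod_cast hdvd

/-- Since `b` is coprime with the denominators of the exponents, `L` preserves the part of a
solution whose exponents have a given denominator; the order of this part is minus the slope of an
admissible edge. -/
theorem den_dvd_ramBound (h0 : l 0 ≠ 0) (hlam : lam ≠ 0) (hp : twistedOp b l lam p = 0) {a : ℚ}
    (ha : p.1.coeff a ≠ 0) : a.den ∣ ramBound b l lam := by
  classical
  set S : Set ℚ := {c | c.den = a.den}
  have hsol : twistedOp b l lam (restrictExponents S p) = 0 := by
    rw [twistedOp_restrictExponents b l, hp]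
    · exact puiseux_ext fun c => Set.indicator_apply_eq_zero.2 fun _ => rfl
    · intro c hc k j
      change _ = _ ↔ _ = _
      rw [den_pow_mul_add (coprime_den_of_coeff_ne_zero h0 hp hc)]
  have hne : restrictExponents S p ≠ 0 := restrictExponents_ne_zero rfl ha
  obtain ⟨e, he, hadm, hslope⟩ := exists_admissible_edge h0 hlam hne hsol
  have hden : (edgeSlope b e.1 e.2).den = a.den := by
    rw [hslope, Rat.neg_den]
    exact order_restrictExponents_mem hne
  have hcop : Nat.Coprime b (edgeSlope b e.1 e.2).den :=
    hden ▸ coprime_den_of_coeff_ne_zero h0 hp ha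
  rw [← hden]
  exact Finset.dvd_lcm (Finset.mem_filter.2 ⟨he, hadm, hcop⟩)

theorem mem_ramifiedLaurent_ramBound (h0 : l 0 ≠ 0) (hlam : lam ≠ 0)
    (hp : twistedOp b l lam p = 0) :
    p.1 ∈ ramifiedLaurent E (ramBound b l lam) (ramBound_pos b l lam) := by
  rw [mem_ramifiedLaurent_iff]
  intro a ha
  obtain ⟨m, hm⟩ := den_dvd_ramBound h0 hlam hp ha
  have hm0 : (m : ℚ) ≠ 0 := by
    have hpos := ramBound_pos b l lam
    rw [hm] at hpos
    exact Nat.cast_ne_zero.2 (Nat.pos_of_mul_pos_left hpos).ne'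
  refine ⟨a.num * m, ?_⟩
  rw [hm]
  push_cast
  rw [mul_div_mul_right _ _ hm0, Rat.num_div_den]

end Ramification

section ScalarExtension

variable {E E₁ E₂ : Type*} [Field E] [Field E₁] [Field E₂] [Algebra E E₁] [Algebra E E₂]

/-- The image of a Puiseux series under a linear map applied to its coefficients. -/
def mapCoeff (f : E₁ →ₗ[E] E₂) (p : Puiseux E₁) : Puiseux E₂ :=
  ⟨p.1.map f, mem_puiseuxField_of_support_subset (p := p)
    (Function.support_comp_subset (map_zero f) p.1.coeff)⟩

theorem coeff_mapCoeff (f : E₁ →ₗ[E] E₂) (p : Puiseux E₁) (a : ℚ) :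
    (mapCoeff f p).1.coeff a = f (p.1.coeff a) :=
  rfl

theorem mapCoeff_zero (f : E₁ →ₗ[E] E₂) : mapCoeff f 0 = 0 :=
  puiseux_ext fun _ => map_zero f

variable (b : ℕ) [b.AtLeastTwo] {K : Type*} [Field K] [Algebra K E] [Algebra K E₁] [Algebra K E₂]
  [IsScalarTower K E E₁] [IsScalarTower K E E₂] {r : ℕ} (l : Fin (r + 1) → K[X])

theorem twistedOp_mapCoeff (f : E₁ →ₗ[E] E₂) (lam : E) (p : Puiseux E₁) :
    twistedOp b l (algebraMap E E₂ lam) (mapCoeff f p) =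
      mapCoeff f (twistedOp b l (algebraMap E E₁ lam) p) := by
  refine puiseux_ext fun a => ?_
  rw [coeff_mapCoeff, coeff_twistedOp, coeff_twistedOp, map_sum]
  refine Finset.sum_congr rfl fun T _ => ?_
  rw [coeff_mapCoeff, IsScalarTower.algebraMap_apply K E E₁, IsScalarTower.algebraMap_apply K E E₂,
    ← map_pow, ← map_pow, ← map_mul, ← map_mul, ← Algebra.smul_def, ← Algebra.smul_def, map_smul]

end ScalarExtension

section ScalarDescent

variable (b : ℕ) [b.AtLeastTwo] {K E E' : Type*} [Field K] [Field E] [Field E'] [Algebra K E]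
  [Algebra K E'] [Algebra E E'] [IsScalarTower K E E'] {r : ℕ} (l : Fin (r + 1) → K[X])

/-- An `E`-linear form `E' → E` that does not vanish on some coefficient of a solution over `E'`
turns it into a nonzero solution over `E`. -/
theorem exists_twistedOp_algebraMap_eq_zero_iff (lam : E) :
    (∃ p : Puiseux E', p ≠ 0 ∧ twistedOp b l (algebraMap E E' lam) p = 0) ↔
      ∃ p : Puiseux E, p ≠ 0 ∧ twistedOp b l lam p = 0 := by
  constructor
  · rintro ⟨p, hne, hp⟩
    obtain ⟨f, hf⟩ : ∃ f : Module.Dual E E', f (p.1.coeff p.1.order) ≠ 0 := by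
      by_contra! h
      exact coeff_order_ne_zero hne ((Module.forall_dual_apply_eq_zero_iff E _).1 h)
    refine ⟨mapCoeff f p, fun h => hf ?_, ?_⟩
    · rw [← coeff_mapCoeff, h]
      rfl
    · have h := twistedOp_mapCoeff b l f lam p
      rwa [hp, mapCoeff_zero] at h
  · rintro ⟨p, hne, hp⟩
    refine ⟨mapCoeff (Algebra.linearMap E E') p, fun h => coeff_order_ne_zero hne ?_, ?_⟩
    · apply (algebraMap E E').injective
      rw [map_zero, ← Algebra.linearMap_apply, ← coeff_mapCoeff, h]
      rfl
    · have h := twistedOp_mapCoeff b l (Algebra.linearMap E E') lam p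
      rwa [Algebra.algebraMap_self_apply, hp, mapCoeff_zero] at h

variable {b l} {Kbar : Type*} [Field Kbar] [Algebra K Kbar]

theorem mem_charRoots'_iff (h0 : l 0 ≠ 0) {lam : Kbarˣ} :
    lam ∈ charRoots' b l Kbar ↔ ∃ p ≠ 0, twistedOp b l (lam : Kbar) p = 0 := by
  have hsol : (∃ p : Puiseux Kbar, expTimes lam p ≠ 0 ∧ linOp b l (expTimes lam p) = 0) ↔
      ∃ p ≠ 0, twistedOp b l (lam : Kbar) p = 0 := by
    simp only [linOp_expTimes, ne_eq, MonoidAlgebra.single_eq_zero]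
  refine ⟨fun h => hsol.1 h.2, fun h => ⟨?_, hsol.2 h⟩⟩
  obtain ⟨p, hne, hp⟩ := h
  obtain ⟨e, he, hadm, -⟩ := exists_admissible_edge h0 lam.ne_zero hne hp
  exact ⟨e, he, hadm⟩

theorem charRootsIn_eq_setOf_ne_bot (h0 : l 0 ≠ 0) (F : IntermediateField K Kbar) :
    charRootsIn b l F = {lam | hypSolutions b l F lam ≠ ⊥} := by
  ext lam
  rw [Set.mem_ofPred_eq, hypSolutions_ne_bot_iff,
    ← exists_twistedOp_algebraMap_eq_zero_iff b l (E' := Kbar)]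
  exact mem_charRoots'_iff h0

end ScalarDescent

section Independence

/-- A vector of minimal support, normalised at `j`, is an eigenvector: otherwise the stable
subspace would contain a nonzero vector of smaller support. -/
theorem exists_eigenvector_of_semilinear_stable {F ι : Type*} [Field F] [Finite ι] (sigma : F →+* F)
    (mu : ι → F) {R : Submodule F (ι → F)} (hR : R ≠ ⊥)
    (hstable : ∀ c ∈ R, (fun i => mu i * sigma (c i)) ∈ R) :
    ∃ c ∈ R, c ≠ 0 ∧ ∃ j, ∀ i, mu i * sigma (c i) = mu j * c i := by
  obtain ⟨c', ⟨hc'R, hc'0⟩, hmin⟩ := exists_minimalFor_of_wellFoundedLT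
    (fun c => c ∈ R ∧ c ≠ 0) (fun c => (Function.support c).ncard) ((Submodule.ne_bot_iff R).1 hR)
  obtain ⟨j, hj⟩ := Function.ne_iff.1 hc'0
  set c := (c' j)⁻¹ • c'
  have hcR : c ∈ R := R.smul_mem _ hc'R
  have hcj : c j = 1 := inv_mul_cancel₀ hj
  have hsupp : Function.support c = Function.support c' :=
    Function.support_const_smul_of_ne_zero _ _ (inv_ne_zero hj)
  refine ⟨c, hcR, fun h => one_ne_zero (hcj.symm.trans (congrFun h j)), j, ?_⟩
  set d : ι → F := (fun i => mu i * sigma (c i)) - mu j • c with hd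
  suffices d = 0 from fun i => sub_eq_zero.1 (congrFun this i)
  by_contra hd0
  have hlt : Function.support d ⊂ Function.support c' := by
    rw [← hsupp, Set.ssubset_iff_of_subset]
    · exact ⟨j, by simp [hcj], by simp [hd, hcj]⟩
    · intro i hi (hci : c i = 0)
      refine hi ?_
      rw [hd, Pi.sub_apply, Pi.smul_apply, hci, map_zero, mul_zero, smul_zero, sub_zero]
  have hdR : d ∈ R := R.sub_mem (hstable c hcR) (R.smul_mem _ hcR)
  exact (Set.ncard_lt_ncard hlt).not_ge (hmin ⟨hdR, hd0⟩ (Set.ncard_lt_ncard hlt).le)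

variable {b : ℕ} [b.AtLeastTwo] {K E : Type*} [Field K] [Field E] [Algebra K E] {r : ℕ}
  {l : Fin (r + 1) → K[X]} {ι : Type*} [Fintype ι]

theorem sum_mul_eq_zero_of_tail (h0 : l 0 ≠ 0) {lam : ι → E} {p c : ι → Puiseux E}
    (hp : ∀ i, twistedOp b l (lam i) (p i) = 0)
    (hc : ∀ k : Fin r, ∑ i, c i * (twistedMahler b (lam i) ^ (k + 1 : ℕ)) (p i) = 0) :
    ∑ i, c i * p i = 0 := by
  have hsum : ∑ k : Fin (r + 1), polyToPuiseux K E (l k) *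
      ∑ i, c i * (twistedMahler b (lam i) ^ (k : ℕ)) (p i) = 0 := by
    simp only [Finset.mul_sum]
    rw [Finset.sum_comm]
    refine Finset.sum_eq_zero fun i _ => ?_
    simp only [mul_left_comm _ (c i)]
    rw [← Finset.mul_sum, ← twistedOp_apply, hp, mul_zero]
  rw [Fin.sum_univ_succ] at hsum
  simp only [Fin.val_succ, hc, mul_zero, Finset.sum_const_zero, add_zero] at hsum
  exact (mul_eq_zero.1 hsum).resolve_left ((map_ne_zero_iff _ polyToPuiseux_injective).2 h0)

theorem sum_inv_smul_mahler_mul_eq_zero {lam : ι → E} (hlam : ∀ i, lam i ≠ 0)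
    {p c : ι → Puiseux E} {k : ℕ} (hc : ∑ i, c i * (twistedMahler b (lam i) ^ k) (p i) = 0) :
    ∑ i, (lam i)⁻¹ • mahler b E (c i) * (twistedMahler b (lam i) ^ (k + 1)) (p i) = 0 := by
  have hM := congrArg (mahler b E) hc
  rw [map_sum, map_zero] at hM
  rw [← hM]
  refine Finset.sum_congr rfl fun i _ => ?_
  rw [map_mul, pow_succ', Module.End.mul_apply, twistedMahler_apply, smul_mul_smul_comm,
    inv_mul_cancel₀ (hlam i), one_smul]

theorem exists_const_of_mahler_div_eq {lam mu : Eˣ} {c : Puiseux E}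
    (h : algebraMap E (Puiseux E) (lam : E)⁻¹ * mahler b E c =
      algebraMap E (Puiseux E) (mu : E)⁻¹ * c) :
    ∃ c₀ : E, c = algebraMap E (Puiseux E) c₀ ∧ (c₀ ≠ 0 → lam = mu) := by
  obtain rfl | hc := eq_or_ne c 0
  · exact ⟨0, (map_zero _).symm, fun h => absurd rfl h⟩
  have hM : mahler b E c = ((lam : E) * (mu : E)⁻¹) • c := by
    rw [mul_smul, Algebra.smul_def (mu : E)⁻¹, ← h, ← Algebra.smul_def,
      smul_inv_smul₀ lam.ne_zero]
  obtain ⟨hone, c₀, rfl⟩ := exists_const_of_mahler_eq_smul b hc hM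
  exact ⟨c₀, rfl, fun _ => Units.ext ((mul_inv_eq_one₀ mu.ne_zero).1 hone)⟩

theorem eq_zero_of_mahler_div_eq {lam : ι → Eˣ} {p c : ι → Puiseux E}
    (hli : LinearIndependent E fun i => expTimes (lam i) (p i)) {mu : Eˣ}
    (hc : ∀ i, algebraMap E (Puiseux E) (lam i : E)⁻¹ * mahler b E (c i) =
      algebraMap E (Puiseux E) (mu : E)⁻¹ * c i)
    (hsum : ∑ i, c i * p i = 0) : c = 0 := by
  choose c₀ hc₀ hmu using fun i => exists_const_of_mahler_div_eq (hc i)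
  have hrel : ∑ i, c₀ i • expTimes (lam i) (p i) = 0 := by
    calc ∑ i, c₀ i • expTimes (lam i) (p i) = ∑ i, expTimes mu (c i * p i) := by
          refine Finset.sum_congr rfl fun i _ => ?_
          obtain hi | hi := eq_or_ne (c₀ i) 0
          · simp [hc₀ i, hi]
          · rw [hmu i hi, hc₀ i, ← Algebra.smul_def, MonoidAlgebra.smul_single]
      _ = expTimes mu (∑ i, c i * p i) := (map_sum (MonoidAlgebra.singleAddHom mu) _ _).symm
      _ = 0 := by rw [hsum, expTimes, MonoidAlgebra.single_zero]
  funext i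
  rw [hc₀ i, Fintype.linearIndependent_iff.1 hli c₀ hrel i, map_zero, Pi.zero_apply]

/-- If `r` is smaller than the number of solutions, then their vectors `((λ M)^k p)` with
`1 ≤ k ≤ r` satisfy a linear relation over the Puiseux series. The relations are stable under `M`,
and those that are eigenvectors have constant coefficients, supported on a single `λ`. -/
theorem card_le_of_linearIndependent_expTimes (h0 : l 0 ≠ 0) {lam : ι → Eˣ} {p : ι → Puiseux E}
    (hp : ∀ i, twistedOp b l (lam i : E) (p i) = 0)
    (hli : LinearIndependent E fun i => expTimes (lam i) (p i)) : Fintype.card ι ≤ r := by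
  by_contra! hcard
  set T : (ι → Puiseux E) →ₗ[Puiseux E] (Fin r → Puiseux E) :=
    Fintype.linearCombination (Puiseux E)
      fun i (k : Fin r) => (twistedMahler b (lam i : E) ^ (k + 1 : ℕ)) (p i)
  have mem_ker (c : ι → Puiseux E) : c ∈ LinearMap.ker T ↔
      ∀ k : Fin r, ∑ i, c i * (twistedMahler b (lam i : E) ^ (k + 1 : ℕ)) (p i) = 0 := by
    simp [T, funext_iff, Fintype.linearCombination_apply]
  have hker : LinearMap.ker T ≠ ⊥ := T.ker_ne_bot_of_finrank_lt (by simpa using hcard)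
  have hstable : ∀ c ∈ LinearMap.ker T,
      (fun i => algebraMap E (Puiseux E) (lam i : E)⁻¹ * mahler b E (c i)) ∈ LinearMap.ker T := by
    intro c hc
    rw [mem_ker] at hc ⊢
    rintro ⟨_ | k, hk⟩
    · simpa [Algebra.smul_def] using sum_inv_smul_mahler_mul_eq_zero (b := b) (k := 0)
        (fun i => (lam i).ne_zero) (sum_mul_eq_zero_of_tail h0 hp hc)
    · simpa [Algebra.smul_def] using sum_inv_smul_mahler_mul_eq_zero
        (fun i => (lam i).ne_zero) (hc ⟨k, k.lt_succ_self.trans hk⟩)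
  obtain ⟨c, hc, hc0, j, hcj⟩ :=
    exists_eigenvector_of_semilinear_stable (mahler b E : Puiseux E →+* Puiseux E) _ hker hstable
  exact hc0 (eq_zero_of_mahler_div_eq hli hcj (sum_mul_eq_zero_of_tail h0 hp ((mem_ker c).1 hc)))

end Independence

section Dimension

theorem finite_setOf_ne_bot_of_sum_finrank_le {E V ι : Type*} [Field E] [AddCommGroup V]
    [Module E V] {W : ι → Submodule E V} (hW : ∀ i, FiniteDimensional E (W i)) {r : ℕ}
    (hr : ∀ s : Finset ι, ∑ i ∈ s, Module.finrank E (W i) ≤ r) : {i | W i ≠ ⊥}.Finite := by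
  by_contra hinf
  obtain ⟨s, hs, hcard⟩ := Set.Infinite.exists_subset_card_eq hinf (r + 1)
  have hpos : ∀ i ∈ s, 1 ≤ Module.finrank E (W i) :=
    fun i hi => Submodule.one_le_finrank_iff.2 (hs hi)
  have hle := (Finset.card_nsmul_le_sum s _ 1 hpos).trans (hr s)
  rw [hcard, smul_eq_mul, mul_one] at hle
  exact r.lt_irrefl hle

variable {b : ℕ} [b.AtLeastTwo] {K E : Type*} [Field K] [Field E] [Algebra K E] {r : ℕ}
  {l : Fin (r + 1) → K[X]}

theorem finiteDimensional_hypSolutions (h0 : l 0 ≠ 0) (lam : Eˣ) :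
    FiniteDimensional E (hypSolutions b l E lam) := by
  have hfree : Module.Free E (hypSolutions b l E lam) := .of_divisionRing ..
  refine Module.rank_lt_aleph0_iff.1 ((rank_le (n := r) fun s hs => ?_).trans_lt
    Cardinal.natCast_lt_aleph0)
  choose p hp hpy using fun y : s => (mem_hypSolutions b l).1 y.1.2
  rw [← Fintype.card_coe]
  refine card_le_of_linearIndependent_expTimes h0 hp (lam := fun _ => lam) ?_
  simp only [hpy]
  exact hs.map' (Submodule.subtype _) (Submodule.ker_subtype _)

theorem linearIndependent_expTimes {κ : Eˣ → Type*} {p : ∀ lam, κ lam → Puiseux E}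
    (hp : ∀ lam, LinearIndependent E (p lam)) :
    LinearIndependent E fun ij : Σ lam, κ lam => expTimes ij.1 (p ij.1 ij.2) :=
  (Finsupp.linearIndependent_single p hp).map' (MonoidAlgebra.coeffLinearEquiv E).symm.toLinearMap
    (LinearEquiv.ker _)

theorem sum_le_of_linearIndependent (h0 : l 0 ≠ 0) (s : Finset Eˣ) {n : Eˣ → ℕ}
    {p : ∀ lam, Fin (n lam) → Puiseux E} (hli : ∀ lam, LinearIndependent E (p lam))
    (hp : ∀ (lam : Eˣ) (j : Fin (n lam)), twistedOp b l (lam : E) (p lam j) = 0) :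
    ∑ lam ∈ s, n lam ≤ r := by
  have hli' : LinearIndependent E
      fun ij : Σ lam : s, Fin (n lam) => expTimes (ij.1 : Eˣ) (p ij.1 ij.2) :=
    (linearIndependent_expTimes hli).comp
      (Sigma.map Subtype.val fun _ => id : (Σ lam : s, Fin (n lam)) → Σ lam, Fin (n lam))
      (Subtype.val_injective.sigma_map fun _ => Function.injective_id)
  calc ∑ lam ∈ s, n lam = Fintype.card (Σ lam : s, Fin (n lam)) := by
        rw [Fintype.card_sigma, ← Finset.sum_coe_sort s]
        simp only [Fintype.card_fin]
    _ ≤ r := card_le_of_linearIndependent_expTimes (b := b) (l := l) (lam := fun ij => (ij.1 : Eˣ))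
        (p := fun ij : Σ lam : s, Fin (n lam) => p ij.1 ij.2) h0 (fun ij => hp ij.1 ij.2) hli'

theorem sum_finrank_hypSolutions_le (h0 : l 0 ≠ 0) (s : Finset Eˣ) :
    ∑ lam ∈ s, Module.finrank E (hypSolutions b l E lam) ≤ r := by
  have hfin (lam : Eˣ) := finiteDimensional_hypSolutions (b := b) h0 lam
  have hfree (lam : Eˣ) : Module.Free E (hypSolutions b l E lam) := .of_divisionRing ..
  let B (lam : Eˣ) := (Module.finBasis E (hypSolutions b l E lam)).map
    (hypSolutionsEquiv b l lam).symm
  refine sum_le_of_linearIndependent h0 s (p := fun lam j => (B lam j).1) (fun lam => ?_)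
    fun lam j => (B lam j).2
  exact (B lam).linearIndependent.map' (Submodule.subtype _) (Submodule.ker_subtype _)

theorem sum_finrank_sub_one_le (h0 : l 0 ≠ 0) (s : Finset Eˣ) :
    ∑ lam ∈ s, ((Module.finrank E (hypSolutions b l E lam) : ℤ) - 1) ≤ (r : ℤ) - s.card := by
  rw [Finset.sum_sub_distrib, Finset.sum_const, nsmul_one]
  exact sub_le_sub_right (mod_cast sum_finrank_hypSolutions_le h0 s) _

end Dimension

/-! ### The first-order equation -/

section PowerSeries

variable (b : ℕ) [b.AtLeastTwo] {R : Type*} [CommRing R]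

/-- The coefficients of the power series `h` with `h(0) = 1` and `h(x^b) = g(x) h(x)`, where
`g(0) = 1`. -/
def expandSolutionCoeff (g : PowerSeries R) : ℕ → R
  | 0 => 1
  | n + 1 =>
    (if b ∣ n + 1 then
      have : (n + 1) / b < n + 1 := Nat.div_lt_self n.succ_pos (Nat.AtLeastTwo.prop (n := b))
      expandSolutionCoeff g ((n + 1) / b) else 0)
      - ∑ j : Fin (n + 1), expandSolutionCoeff g j * PowerSeries.coeff (n + 1 - j) g

theorem exists_expand_eq_mul {g : PowerSeries R} (hg : PowerSeries.constantCoeff g = 1) :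
    ∃ h : PowerSeries R, PowerSeries.constantCoeff h = 1 ∧
      PowerSeries.expand b (NeZero.ne b) h = g * h := by
  refine ⟨PowerSeries.mk (expandSolutionCoeff b g), ?_, ?_⟩
  · rw [← PowerSeries.coeff_zero_eq_constantCoeff_apply, PowerSeries.coeff_mk, expandSolutionCoeff]
  ext n
  rw [mul_comm, PowerSeries.coeff_expand, PowerSeries.coeff_mul,
    Finset.Nat.sum_antidiagonal_eq_sum_range_succ
      (fun i j => PowerSeries.coeff i (.mk (expandSolutionCoeff b g)) * PowerSeries.coeff j g),
    Finset.sum_range_succ, Nat.sub_self, PowerSeries.coeff_zero_eq_constantCoeff_apply, hg, mul_one]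
  simp only [PowerSeries.coeff_mk]
  cases n with
  | zero => simp
  | succ n => rw [Finset.sum_range, expandSolutionCoeff, add_sub_cancel]

end PowerSeries

section FirstOrder

variable (b : ℕ) [b.AtLeastTwo] {E : Type*} [Field E]

/-- The power series in `x ^ (1 / q)` as Puiseux series. -/
def rootPowerSeries {q : ℕ} (hq : 0 < q) : PowerSeries E →+* Puiseux E :=
  ((laurentRoot E q hq).toRingHom.comp (ofPowerSeries ℤ E)).codRestrict (puiseuxField E)
    fun _ => ⟨q, hq, _, rfl⟩

theorem coeff_rootPowerSeries {q : ℕ} (hq : 0 < q) (f : PowerSeries E) (n : ℕ) :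
    (rootPowerSeries hq f).1.coeff (n / q) = PowerSeries.coeff n f :=
  (embDomain_coeff (x := ofPowerSeries ℤ E f) (a := (n : ℤ))).trans (ofPowerSeries_apply_coeff f n)

theorem coeff_rootPowerSeries_eq_zero {q : ℕ} (hq : 0 < q) (f : PowerSeries E) {a : ℚ}
    (ha : ∀ n : ℕ, a ≠ n / q) : (rootPowerSeries hq f).1.coeff a = 0 := by
  by_contra hne
  obtain ⟨z, -, rfl⟩ := support_embDomain_subset hne
  have hz : (ofPowerSeries ℤ E f).coeff z ≠ 0 := fun h => hne (embDomain_coeff.trans h)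
  rw [ofPowerSeries_apply] at hz
  obtain ⟨n, -, rfl⟩ := support_embDomain_subset hz
  exact ha n rfl

theorem rootPowerSeries_C {q : ℕ} (hq : 0 < q) (c : E) :
    rootPowerSeries hq (PowerSeries.C c) = algebraMap E (Puiseux E) c := by
  refine Subtype.ext ?_
  change laurentRoot E q hq (ofPowerSeries ℤ E (PowerSeries.C c)) = _
  rw [ofPowerSeries_C]
  exact (laurentRoot E q hq).commutes c

theorem mahler_rootPowerSeries {q : ℕ} (hq : 0 < q) (f : PowerSeries E) :
    mahler b E (rootPowerSeries hq f) =
      rootPowerSeries hq (PowerSeries.expand b (NeZero.ne b) f) := by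
  have hdiv (k : ℕ) : ((b * k : ℕ) : ℚ) / q = b * (k / q) := by
    push_cast
    ring
  refine puiseux_ext fun a => ?_
  by_cases ha : ∃ k : ℕ, a / b = k / q
  · obtain ⟨k, hk⟩ := ha
    rw [coeff_mahler, hk, coeff_rootPowerSeries, (div_eq_iff (radix_ne_zero b)).1 hk, mul_comm,
      ← hdiv, coeff_rootPowerSeries, PowerSeries.coeff_expand_mul]
  · push Not at ha
    rw [coeff_mahler, coeff_rootPowerSeries_eq_zero hq f ha]
    by_cases ha' : ∃ n : ℕ, a = n / q
    · obtain ⟨n, rfl⟩ := ha'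
      rw [coeff_rootPowerSeries, PowerSeries.coeff_expand_of_not_dvd]
      rintro ⟨k, rfl⟩
      exact ha k (by rw [hdiv, mul_div_cancel_left₀ _ (radix_ne_zero b)])
    · push Not at ha'
      rw [coeff_rootPowerSeries_eq_zero hq _ ha']

/-- The Puiseux series `x ^ v`. -/
def puiseuxMonomial (E : Type*) [Field E] (v : ℚ) : Puiseux E :=
  ⟨single v 1, v.den, v.den_pos, (mem_ramifiedLaurent_iff v.den_pos _).2 fun a ha =>
    ⟨v.num, by rw [Rat.num_div_den]; exact of_not_not fun h => ha (coeff_single_of_ne h)⟩⟩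

theorem puiseuxMonomial_ne_zero (v : ℚ) : puiseuxMonomial E v ≠ 0 :=
  fun h => single_ne_zero one_ne_zero (congrArg Subtype.val h)

theorem puiseuxMonomial_mul (v w : ℚ) :
    puiseuxMonomial E v * puiseuxMonomial E w = puiseuxMonomial E (v + w) :=
  Subtype.ext (single_mul_single.trans (by rw [mul_one]; rfl))

theorem mahler_puiseuxMonomial (v : ℚ) :
    mahler b E (puiseuxMonomial E v) = puiseuxMonomial E (b * v) :=
  Subtype.ext embDomain_single

theorem exists_eq_smul_monomial_mul_rootPowerSeries {u : Puiseux E} (hu : u ≠ 0) :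
    ∃ (c : Eˣ) (v : ℚ) (q : ℕ) (hq : 0 < q) (g : PowerSeries E),
      PowerSeries.constantCoeff g = 1 ∧
        u = (c : E) • (puiseuxMonomial E v * rootPowerSeries hq g) := by
  obtain ⟨_, q, hq, f, rfl⟩ := u
  have hf : f ≠ 0 := by
    rintro rfl
    exact hu (Subtype.ext (map_zero (laurentRoot E q hq)))
  have hc : f.leadingCoeff ≠ 0 := leadingCoeff_ne_zero.2 hf
  set g := LaurentSeries.powerSeriesPart f with hg
  have hg0 : PowerSeries.constantCoeff g = f.leadingCoeff := by
    rw [← PowerSeries.coeff_zero_eq_constantCoeff_apply, LaurentSeries.powerSeriesPart_coeff,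
      Nat.cast_zero, add_zero, leadingCoeff_eq]
  refine ⟨Units.mk0 _ hc, f.order / q, q, hq, PowerSeries.C f.leadingCoeff⁻¹ * g, ?_, ?_⟩
  · rw [map_mul, hg0, PowerSeries.constantCoeff_C, inv_mul_cancel₀ hc]
  rw [Units.val_mk0, map_mul, rootPowerSeries_C, ← Algebra.smul_def, mul_smul_comm,
    smul_inv_smul₀ hc]
  refine Subtype.ext ?_
  calc laurentRoot E q hq f
    _ = laurentRoot E q hq (single f.order 1 * ofPowerSeries ℤ E g) := by
      rw [hg, LaurentSeries.single_order_mul_powerSeriesPart f]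
    _ = single ((f.order : ℚ) / q) 1 * (rootPowerSeries hq g).1 := by
      rw [map_mul]
      exact congrArg (· * _) embDomain_single

/-- If `u = c x^v g` with `g(0) = 1`, then `λ = c` and `p = x^{v / (b - 1)} h`, where
`h(x^b) = g(x) h(x)`. -/
theorem exists_twistedMahler_eq_mul {u : Puiseux E} (hu : u ≠ 0) :
    ∃ lam : Eˣ, ∃ p ≠ 0, twistedMahler b (lam : E) p = u * p := by
  obtain ⟨c, v, q, hq, g, hg, rfl⟩ := exists_eq_smul_monomial_mul_rootPowerSeries hu
  obtain ⟨h, hh, hexpand⟩ := exists_expand_eq_mul b hg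
  have hroot : rootPowerSeries hq h ≠ 0 := by
    intro hzero
    have hcoeff := coeff_rootPowerSeries hq h 0
    rw [hzero, PowerSeries.coeff_zero_eq_constantCoeff_apply, hh] at hcoeff
    exact zero_ne_one hcoeff
  have hexp : (b : ℚ) * (v / (b - 1)) = v + v / (b - 1) := by
    have := sub_ne_zero.2 (one_lt_radix b).ne'
    field_simp
    ring
  refine ⟨c, puiseuxMonomial E (v / (b - 1)) * rootPowerSeries hq h,
    mul_ne_zero (puiseuxMonomial_ne_zero _) hroot, ?_⟩
  rw [twistedMahler_apply, map_mul, mahler_puiseuxMonomial, hexp, ← puiseuxMonomial_mul,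
    mahler_rootPowerSeries, hexpand, map_mul, smul_mul_assoc, mul_mul_mul_comm]

end FirstOrder

/-! ### The solutions of the Riccati equation -/

section Riccati

variable {b : ℕ} [b.AtLeastTwo] {E : Type*} [Field E]

theorem isMahlerQuotient_expTimes {lam : Eˣ} {p : Puiseux E} (hp : p ≠ 0) {u : Puiseux E} :
    IsMahlerQuotient b u (expTimes lam p) ↔ twistedMahler b (lam : E) p = u * p := by
  have hunit : IsUnit (expTimes lam p) := by
    refine IsUnit.of_mul_eq_one (expTimes lam⁻¹ p⁻¹) ?_
    rw [MonoidAlgebra.single_mul_single, mul_inv_cancel, mul_inv_cancel₀ hp, MonoidAlgebra.one_def]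
  rw [IsMahlerQuotient, and_iff_right hunit, mahlerD_expTimes, MonoidAlgebra.smul_single,
    MonoidAlgebra.single_right_inj]
  exact Iff.rfl

theorem twistedMahler_pow_eq_prod_mul {lam : E} {u p : Puiseux E}
    (h : twistedMahler b lam p = u * p) (k : ℕ) :
    (twistedMahler b lam ^ k) p = (∏ i ∈ Finset.range k, (mahler b E)^[i] u) * p := by
  induction k with
  | zero => simp
  | succ k ih =>
    rw [pow_succ', Module.End.mul_apply, ih, twistedMahler_mul, h, map_prod,
      Finset.prod_range_succ', mul_assoc]
    simp only [← Function.iterate_succ_apply' (mahler b E), Function.iterate_zero_apply]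

theorem leadingCoeff_eq_of_twistedMahler_eq_mul {lam : E} {u p : Puiseux E} (hp : p ≠ 0)
    (h : twistedMahler b lam p = u * p) : u.1.leadingCoeff = lam := by
  have hlead : (lam • mahler b E p).1.leadingCoeff = (u * p).1.leadingCoeff :=
    congrArg (fun f : Puiseux E => f.1.leadingCoeff) h
  rw [leadingCoeff_smul_puiseux, leadingCoeff_mahler, MulMemClass.coe_mul,
    HahnSeries.leadingCoeff_mul] at hlead
  exact (mul_right_cancel₀ (leadingCoeff_puiseux_ne_zero hp) hlead).symm

variable {K : Type*} [Field K] [Algebra K E] {r : ℕ} {l : Fin (r + 1) → K[X]}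

theorem mem_riccatiSolutions_iff {lam : E} {u p : Puiseux E} (hp : p ≠ 0)
    (h : twistedMahler b lam p = u * p) :
    u ∈ riccatiSolutions b l E ↔ twistedOp b l lam p = 0 := by
  simp only [twistedOp_apply, twistedMahler_pow_eq_prod_mul h, ← mul_assoc, ← Finset.sum_mul,
    mul_eq_zero, or_iff_left hp]
  exact Iff.rfl

theorem ne_zero_of_mem_riccatiSolutions (h0 : l 0 ≠ 0) {u : Puiseux E}
    (hu : u ∈ riccatiSolutions b l E) : u ≠ 0 := by
  rintro rfl
  have hsum : ∑ k : Fin (r + 1), polyToPuiseux K E (l k) *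
    ∏ i ∈ Finset.range k, (mahler b E)^[i] 0 = 0 := hu
  simp only [iterate_map_zero, Finset.prod_const, Finset.card_range, Fin.sum_univ_succ,
    Fin.val_zero, pow_zero, mul_one, Fin.val_succ, zero_pow (Nat.succ_ne_zero _), mul_zero,
    Finset.sum_const_zero, add_zero] at hsum
  exact (map_ne_zero_iff _ polyToPuiseux_injective).2 h0 hsum

theorem mem_riccatiClass_iff {lam : Eˣ} {u : Puiseux E} :
    u ∈ riccatiClass b l E lam ↔
      ∃ p ≠ 0, twistedOp b l (lam : E) p = 0 ∧ twistedMahler b (lam : E) p = u * p := by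
  constructor
  · rintro ⟨y, hy, hne, hu⟩
    obtain ⟨p, hp, rfl⟩ := (mem_hypSolutions b l).1 hy
    have hp0 : p ≠ 0 := MonoidAlgebra.single_eq_zero.not.1 hne
    exact ⟨p, hp0, hp, (isMahlerQuotient_expTimes hp0).1 hu⟩
  · rintro ⟨p, hp0, hp, hu⟩
    exact ⟨expTimes lam p, (mem_hypSolutions b l).2 ⟨p, hp, rfl⟩,
      MonoidAlgebra.single_eq_zero.not.2 hp0, (isMahlerQuotient_expTimes hp0).2 hu⟩

theorem riccatiSolutions_eq_iUnion (h0 : l 0 ≠ 0) :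
    riccatiSolutions b l E =
      ⋃ lam ∈ {lam | hypSolutions b l E lam ≠ ⊥}, riccatiClass b l E lam := by
  ext u
  simp only [Set.mem_iUnion, Set.mem_ofPred_eq, hypSolutions_ne_bot_iff, mem_riccatiClass_iff,
    exists_prop]
  constructor
  · intro hu
    obtain ⟨lam, p, hp0, hup⟩ :=
      exists_twistedMahler_eq_mul b (ne_zero_of_mem_riccatiSolutions h0 hu)
    have hp := (mem_riccatiSolutions_iff hp0 hup).1 hu
    exact ⟨lam, ⟨p, hp0, hp⟩, p, hp0, hp, hup⟩
  · rintro ⟨lam, -, p, hp0, hp, hup⟩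
    exact (mem_riccatiSolutions_iff hp0 hup).2 hp

theorem leadingCoeff_of_mem_riccatiClass {lam : Eˣ} {u : Puiseux E}
    (hu : u ∈ riccatiClass b l E lam) : u.1.leadingCoeff = lam := by
  obtain ⟨p, hp0, -, hup⟩ := mem_riccatiClass_iff.1 hu
  exact leadingCoeff_eq_of_twistedMahler_eq_mul hp0 hup

theorem pairwise_disjoint_riccatiClass :
    Pairwise (Function.onFun Disjoint (riccatiClass b l E)) := fun _ _ hne =>
  Set.disjoint_left.2 fun _ hu hu' => hne <| Units.ext <|
    (leadingCoeff_of_mem_riccatiClass hu).symm.trans (leadingCoeff_of_mem_riccatiClass hu')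

theorem mem_ramifiedLaurent_of_mem_riccatiClass (h0 : l 0 ≠ 0) {lam : Eˣ} {u : Puiseux E}
    (hu : u ∈ riccatiClass b l E lam) :
    u.1 ∈ ramifiedLaurent E (ramBound b l (lam : E)) (ramBound_pos b l (lam : E)) := by
  obtain ⟨p, hp0, hp, hup⟩ := mem_riccatiClass_iff.1 hu
  have hmem := mem_ramifiedLaurent_ramBound h0 lam.ne_zero hp
  have hdiv : u = twistedMahler b (lam : E) p / p := eq_div_of_mul_eq hp0 hup.symm
  have hcoe : u.1 = (twistedMahler b (lam : E) p).1 / p.1 := congrArg Subtype.val hdiv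
  rw [hcoe]
  exact div_mem
    (smul_mem_ramifiedLaurent _ (lam : E) (mahler_mem_ramifiedLaurent _ b hmem)) hmem

end Riccati

/-! ### The quotient map on the projective space of solutions -/

section ProjQuotient

variable {E V F : Type*} [Field E] [AddCommGroup V] [Module E V] [Field F] [Algebra E F]

/-- The quotient `[v] ↦ f v / g v` of two linear forms with values in an extension field, as a map
on the projectivization. -/
def projQuotient (f g : V →ₗ[E] F) : Projectivization E V → F :=
  Projectivization.lift (fun v => f v / g v) <| by
    rintro ⟨v, hv⟩ ⟨w, -⟩ t (rfl : v = t • w)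
    have ht : algebraMap E F t ≠ 0 := (_root_.map_ne_zero _).2 (smul_ne_zero_iff.1 hv).1
    simp only [map_smul, Algebra.smul_def, mul_div_mul_left _ _ ht]

theorem projQuotient_mk (f g : V →ₗ[E] F) {v : V} (hv : v ≠ 0) :
    projQuotient f g (Projectivization.mk E v hv) = f v / g v :=
  rfl

theorem isRationalOnProj_projQuotient (f : V →ₗ[E] F) {g : V →ₗ[E] F}
    (hg : Function.Injective g) : IsRationalOnProj (projQuotient f g) := by
  intro n v
  let form (h : V →ₗ[E] F) : MvPolynomial (Fin n) F :=
    ∑ i, MvPolynomial.C (h (v i)) * MvPolynomial.X i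
  have hform (h : V →ₗ[E] F) : (form h).IsHomogeneous 1 :=
    MvPolynomial.IsHomogeneous.sum _ _ _ fun i _ => MvPolynomial.isHomogeneous_C_mul_X _ i
  have heval (h : V →ₗ[E] F) (c : Fin n → E) :
      MvPolynomial.eval (fun i => algebraMap E F (c i)) (form h) = h (∑ i, c i • v i) := by
    simp only [form, map_sum, map_mul, MvPolynomial.eval_C, MvPolynomial.eval_X, map_smul,
      Algebra.smul_def, mul_comm]
  refine ⟨1, form f, form g, hform f, hform g, fun c hc => ?_⟩
  rw [heval, heval, projQuotient_mk]
  exact ⟨(map_ne_zero_iff g hg).2 hc, rfl⟩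

end ProjQuotient

section QuotientMap

variable (b : ℕ) [b.AtLeastTwo] {K E : Type*} [Field K] [Field E] [Algebra K E] {r : ℕ}
  (l : Fin (r + 1) → K[X]) (lam : Eˣ)

/-- The Puiseux factor `p` of a solution `e_λ p`. -/
def hypFactor : hypSolutions b l E lam →ₗ[E] Puiseux E :=
  (LinearMap.ker (twistedOp b l (lam : E))).subtype ∘ₗ (hypSolutionsEquiv b l lam).symm

theorem hypFactor_injective : Function.Injective (hypFactor b l lam) :=
  Subtype.val_injective.comp (hypSolutionsEquiv b l lam).symm.injective

theorem expTimes_hypFactor (y : hypSolutions b l E lam) : expTimes lam (hypFactor b l lam y) = y :=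
  congrArg Subtype.val ((hypSolutionsEquiv b l lam).apply_symm_apply y)

/-- The map `[y] ↦ M y / y` on `ℙ(𝔥_λ)`, written as `[e_λ p] ↦ λ M p / p`. -/
def mahlerQuotientMap : Projectivization E (hypSolutions b l E lam) → Puiseux E :=
  projQuotient (twistedMahler b (lam : E) ∘ₗ hypFactor b l lam) (hypFactor b l lam)

variable {b l lam}

theorem isMahlerQuotient_mahlerQuotientMap_mk {y : hypSolutions b l E lam} (hy : y ≠ 0) :
    IsMahlerQuotient b (mahlerQuotientMap b l lam (Projectivization.mk E y hy))
      (y : GenSeries E) := by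
  have hp : hypFactor b l lam y ≠ 0 := (map_ne_zero_iff _ (hypFactor_injective b l lam)).2 hy
  rw [← expTimes_hypFactor, isMahlerQuotient_expTimes hp, mahlerQuotientMap, projQuotient_mk,
    div_mul_cancel₀ _ hp]
  rfl

theorem IsMahlerQuotient.unique {u v : Puiseux E} {y : GenSeries E} (hu : IsMahlerQuotient b u y)
    (hv : IsMahlerQuotient b v y) : u = v := by
  have h : u • y = v • y := hu.2.symm.trans hv.2
  rw [Algebra.smul_def, Algebra.smul_def] at h
  exact FaithfulSMul.algebraMap_injective (Puiseux E) (GenSeries E) (hu.1.mul_right_cancel h)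

theorem range_mahlerQuotientMap :
    Set.range (mahlerQuotientMap b l lam) = riccatiClass b l E lam := by
  ext u
  constructor
  · rintro ⟨⟨y, hy⟩, rfl⟩
    exact ⟨y, y.2, ZeroMemClass.coe_eq_zero.not.2 hy, isMahlerQuotient_mahlerQuotientMap_mk hy⟩
  · rintro ⟨y, hy, hne, hu⟩
    have hne' : (⟨y, hy⟩ : hypSolutions b l E lam) ≠ 0 := ZeroMemClass.coe_eq_zero.not.1 hne
    exact ⟨.mk E ⟨y, hy⟩ hne', (isMahlerQuotient_mahlerQuotientMap_mk hne').unique hu⟩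

/-- If `M p / p = M q / q`, then `p / q` is fixed by `M`, hence constant. -/
theorem mahlerQuotientMap_injective : Function.Injective (mahlerQuotientMap b l lam) := by
  rintro ⟨x, hx⟩ ⟨y, hy⟩ h
  set p := hypFactor b l lam x with hp
  set q := hypFactor b l lam y with hq
  have hp0 : p ≠ 0 := (map_ne_zero_iff _ (hypFactor_injective b l lam)).2 hx
  have hq0 : q ≠ 0 := (map_ne_zero_iff _ (hypFactor_injective b l lam)).2 hy
  have hquot : (lam : E) • mahler b E p / p = (lam : E) • mahler b E q / q := h
  have hfix : mahler b E (p / q) = (1 : E) • (p / q) := by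
    have hlam : algebraMap E (Puiseux E) lam ≠ 0 := (_root_.map_ne_zero _).2 lam.ne_zero
    rw [Algebra.smul_def, Algebra.smul_def, mul_div_assoc, mul_div_assoc] at hquot
    rw [one_smul, map_div₀, div_eq_div_iff ((_root_.map_ne_zero _).2 hq0) hq0, mul_comm p]
    exact (div_eq_div_iff hp0 hq0).1 (mul_left_cancel₀ hlam hquot)
  obtain ⟨-, c, hc⟩ := exists_const_of_mahler_eq_smul b (div_ne_zero hp0 hq0) hfix
  refine (Projectivization.mk_eq_mk_iff' E x y hx hy).2 ⟨c, hypFactor_injective b l lam ?_⟩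
  rw [map_smul, ← hp, ← hq, Algebra.smul_def, ← hc, div_mul_cancel₀ _ hq0]

end QuotientMap

end MahlerRiccati

end

theorem mainTheorem5_general {K Kbar : Type*} [Field K] [Field Kbar] [Algebra K Kbar]
    (F : IntermediateField K Kbar) (b : ℕ) [b.AtLeastTwo] (r : ℕ)
    (l : Fin (r + 1) → Polynomial K) (h0 : l 0 ≠ 0) :
    MahlerRiccati.riccatiSolutions b l F =
        ⋃ lam ∈ MahlerRiccati.charRootsIn b l F, MahlerRiccati.riccatiClass b l F lam ∧
    (MahlerRiccati.charRootsIn b l F).PairwiseDisjoint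
        (fun lam => MahlerRiccati.riccatiClass b l F lam) ∧
    (∀ lam ∈ MahlerRiccati.charRootsIn b l F,
      (∀ u ∈ MahlerRiccati.riccatiClass b l F lam,
        (u : HahnSeries ℚ F) ∈
            MahlerRiccati.ramifiedLaurent F (MahlerRiccati.ramBound b l (lam : F))
              (MahlerRiccati.ramBound_pos b l (lam : F)) ∧
          (u : HahnSeries ℚ F).leadingCoeff = (lam : F)) ∧
      Module.Finite F (MahlerRiccati.hypSolutions b l F lam) ∧
      Nontrivial (MahlerRiccati.hypSolutions b l F lam) ∧
      ∃ φ : Projectivization F (MahlerRiccati.hypSolutions b l F lam) →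
          MahlerRiccati.Puiseux F,
        Function.Injective φ ∧
        Set.range φ = MahlerRiccati.riccatiClass b l F lam ∧
        (∀ (y : MahlerRiccati.hypSolutions b l F lam) (hy : y ≠ 0),
          MahlerRiccati.IsMahlerQuotient b (φ (Projectivization.mk F y hy))
            (y : MahlerRiccati.GenSeries F)) ∧
        MahlerRiccati.IsRationalOnProj φ) ∧
    ∃ hfin : (MahlerRiccati.charRootsIn b l F).Finite,
      ∑ lam ∈ hfin.toFinset,
          ((Module.finrank F (MahlerRiccati.hypSolutions b l F lam) : ℤ) - 1) ≤
        (r : ℤ) - hfin.toFinset.card := by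
  rw [MahlerRiccati.charRootsIn_eq_setOf_ne_bot h0 F]
  have hfinDim := MahlerRiccati.finiteDimensional_hypSolutions (b := b) (E := F) h0
  refine ⟨MahlerRiccati.riccatiSolutions_eq_iUnion h0,
    MahlerRiccati.pairwise_disjoint_riccatiClass.set_pairwise _, fun lam hlam => ?_,
    MahlerRiccati.finite_setOf_ne_bot_of_sum_finrank_le hfinDim
      (MahlerRiccati.sum_finrank_hypSolutions_le h0),
    MahlerRiccati.sum_finrank_sub_one_le h0 _⟩
  refine ⟨fun u hu => ⟨MahlerRiccati.mem_ramifiedLaurent_of_mem_riccatiClass h0 hu,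
    MahlerRiccati.leadingCoeff_of_mem_riccatiClass hu⟩, hfinDim lam,
    Submodule.nontrivial_iff_ne_bot.2 hlam, MahlerRiccati.mahlerQuotientMap b l lam,
    MahlerRiccati.mahlerQuotientMap_injective, MahlerRiccati.range_mahlerQuotientMap,
    fun _ hy => MahlerRiccati.isMahlerQuotient_mahlerQuotientMap_mk hy,
    MahlerRiccati.isRationalOnProj_projQuotient _ (MahlerRiccati.hypFactor_injective b l lam)⟩

theorem mainTheorem5 {K Kbar : Type*} [Field K] [CharZero K] [Field Kbar] [Algebra K Kbar]
    [IsAlgClosure K Kbar] (F : IntermediateField K Kbar) (b : ℕ) [b.AtLeastTwo] (r : ℕ)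
    (l : Fin (r + 1) → Polynomial K) (h0 : l 0 ≠ 0) (hr : l (Fin.last r) ≠ 0) :
    MahlerRiccati.riccatiSolutions b l F =
        ⋃ lam ∈ MahlerRiccati.charRootsIn b l F, MahlerRiccati.riccatiClass b l F lam ∧
    (MahlerRiccati.charRootsIn b l F).PairwiseDisjoint
        (fun lam => MahlerRiccati.riccatiClass b l F lam) ∧
    (∀ lam ∈ MahlerRiccati.charRootsIn b l F,
      (∀ u ∈ MahlerRiccati.riccatiClass b l F lam,
        (u : HahnSeries ℚ F) ∈
            MahlerRiccati.ramifiedLaurent F (MahlerRiccati.ramBound b l (lam : F))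
              (MahlerRiccati.ramBound_pos b l (lam : F)) ∧
          (u : HahnSeries ℚ F).leadingCoeff = (lam : F)) ∧
      Module.Finite F (MahlerRiccati.hypSolutions b l F lam) ∧
      Nontrivial (MahlerRiccati.hypSolutions b l F lam) ∧
      ∃ φ : Projectivization F (MahlerRiccati.hypSolutions b l F lam) →
          MahlerRiccati.Puiseux F,
        Function.Injective φ ∧
        Set.range φ = MahlerRiccati.riccatiClass b l F lam ∧
        (∀ (y : MahlerRiccati.hypSolutions b l F lam) (hy : y ≠ 0),
          MahlerRiccati.IsMahlerQuotient b (φ (Projectivization.mk F y hy))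
            (y : MahlerRiccati.GenSeries F)) ∧
        MahlerRiccati.IsRationalOnProj φ) ∧
    ∃ hfin : (MahlerRiccati.charRootsIn b l F).Finite,
      ∑ lam ∈ hfin.toFinset,
          ((Module.finrank F (MahlerRiccati.hypSolutions b l F lam) : ℤ) - 1) ≤
        (r : ℤ) - hfin.toFinset.card :=
  mainTheorem5_general F b r l h0
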